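/- Let $A_2\subset\mathbb{R}^2$ be the hexagonal lattice (the points of $\mathbb{Z}^3$ whose coordinates sum to zero, with the plane they span identified isometrically with $\mathbb{R}^2$), and equip the torus $M=\mathbb{R}^2/A_2$ with the metric $d(x,y)=\min\{\|s-t\|_2 : s\in x,\ t\in y\}$. For a finite set $C\subseteq M$ put $\delta(C)=\min\{d(x,y) : x,y\in C,\ x\neq y\}$ (with $\delta(C)=\infty$ if $|C|\le 1$); call $C$ an optimal code of size $n$ if $|C|=n$ and $\delta(C')\le\delta(C)$ for every $C'\subseteq M$ with $|C'|=n$. Let $n$ be a positive integer such that no prime factor of $n$ is congruent to $1$ modulo $3$ and every prime factor of $n$ that is congruent to $2$ modulo $3$ occurs in $n$ with even multiplicity. Then the optimal code of size $n$ in $M$ is unique up to isometry: an optimal code of size $n$ exists, and for any two optimal codes $C,C'$ of size $n$ there is an isometry of $M$ onto itself that maps $C'$ onto $C$. -/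

import Mathlib

/-- `C` is an optimal code of size `n` in `M`: a set of `n` points whose minimum distance
(`Set.einfsep`, the infimum of the distances between distinct points, which is `∞` for a set with
at most one point) is as large as possible among all sets of `n` points. -/
def IsOptimalCode {M : Type*} [PseudoMetricSpace M] (n : ℕ) (C : Set M) : Prop :=
  (C.Finite ∧ C.ncard = n) ∧
    ∀ C' : Set M, C'.Finite → C'.ncard = n → C'.einfsep ≤ C.einfsep

/-- The optimal code of size `n` in `M` is unique up to isometry: there is an optimal code of size
`n`, and any other one is mapped onto it by an isometry of `M` (a distance-preserving bijection
of the whole space `M`). -/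
def HasUniqueOptimalCode (M : Type*) [PseudoMetricSpace M] (n : ℕ) : Prop :=
  ∃ C : Set M, IsOptimalCode n C ∧
    ∀ C' : Set M, IsOptimalCode n C' → ∃ g : M ≃ᵢ M, g '' C' = C

/-- The root lattice `A₂` (the hexagonal lattice) in the Euclidean plane, generated by
`a = (√2, 0)` and `b = (-√2/2, √6/2)`. One has `⟪a, a⟫ = ⟪b, b⟫ = 2` and `⟪a, b⟫ = -1`, so that
`a ↦ (1, -1, 0)`, `b ↦ (0, 1, -1)` extends to a linear isometry of `ℝ²` onto the plane
`{x ∈ ℝ³ | x₁ + x₂ + x₃ = 0}`, and it maps this lattice onto the set of points of `ℤ³` whose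
coordinates sum to zero; see `exists_linearIsometry_image_latticeA2`. -/
noncomputable def latticeA2 : AddSubgroup (EuclideanSpace ℝ (Fin 2)) :=
  AddSubgroup.closure {!₂[√2, 0], !₂[-√2 / 2, √6 / 2]}

/-- The hexagonal torus `ℝ² / A₂`, with Mathlib's quotient metric. -/
abbrev TorusA2 : Type := EuclideanSpace ℝ (Fin 2) ⧸ latticeA2

/-- The distance of two cosets is the distance of `s - t` to the lattice, that is, the infimum of
`‖(s + u) - (t + v)‖` over lattice vectors `u`, `v`. -/
theorem TorusA2.dist_mk (s t : EuclideanSpace ℝ (Fin 2)) :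
    dist (QuotientAddGroup.mk s : TorusA2) (QuotientAddGroup.mk t) =
      Metric.infDist (s - t) (latticeA2 : Set (EuclideanSpace ℝ (Fin 2))) := by
  rw [dist_eq_norm, ← QuotientAddGroup.mk_sub, QuotientAddGroup.norm_mk]

/-- The lattice above is, up to a linear isometry from `ℝ²` to `ℝ³`, the set of points of `ℤ³` whose
coordinates sum to zero. -/
theorem exists_linearIsometry_image_latticeA2 :
    ∃ J : EuclideanSpace ℝ (Fin 2) →ₗᵢ[ℝ] EuclideanSpace ℝ (Fin 3),
      J '' (latticeA2 : Set (EuclideanSpace ℝ (Fin 2))) =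
        {x | (∀ i, ∃ k : ℤ, x i = (k : ℝ)) ∧ x 0 + x 1 + x 2 = 0} := by
  have h2 : √2 * √2 = 2 := Real.mul_self_sqrt (by norm_num)
  have h6 : √6 * √6 = 6 := Real.mul_self_sqrt (by norm_num)
  have h2' : √2 ^ 2 = 2 := by rw [sq, h2]
  have h6' : √6 ^ 2 = 6 := by rw [sq, h6]
  let f : EuclideanSpace ℝ (Fin 2) →ₗ[ℝ] EuclideanSpace ℝ (Fin 3) :=
    { toFun := fun x => !₂[x 0 * (√2 / 2) + x 1 * (√6 / 6),
        -(x 0 * (√2 / 2)) + x 1 * (√6 / 6), -(x 1 * (√6 / 3))]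
      map_add' := by
        intro x y; ext i; fin_cases i <;> simp <;> ring
      map_smul' := by
        intro c x; ext i; fin_cases i <;> simp <;> ring }
  have hf : ∀ x, f x = !₂[x 0 * (√2 / 2) + x 1 * (√6 / 6),
        -(x 0 * (√2 / 2)) + x 1 * (√6 / 6), -(x 1 * (√6 / 3))] := fun _ => rfl
  have hn : ∀ x, ‖f x‖ = ‖x‖ := by
    intro x
    rw [EuclideanSpace.norm_eq, EuclideanSpace.norm_eq, hf]
    congr 1
    simp [Fin.sum_univ_succ]
    ring_nf
    rw [h2', h6']
    ring
  refine ⟨⟨f, hn⟩, ?_⟩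
  ext y
  simp only [latticeA2, Set.mem_image, SetLike.mem_coe, AddSubgroup.mem_closure_pair,
    Set.mem_ofPred_eq, LinearIsometry.coe_mk]
  constructor
  · rintro ⟨_, ⟨m, n, rfl⟩, rfl⟩
    have e0 : f (m • !₂[√2, 0] + n • !₂[-√2 / 2, √6 / 2]) = !₂[(m : ℝ), n - m, -n] := by
      rw [hf]
      ext i
      fin_cases i <;> simp <;> ring_nf <;> simp only [h2', h6'] <;> ring
    rw [e0]
    refine ⟨fun i => ?_, by simp⟩
    fin_cases i
    · exact ⟨m, by simp⟩
    · exact ⟨n - m, by simp⟩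
    · exact ⟨-n, by simp⟩
  · rintro ⟨hi, hs⟩
    obtain ⟨m, hm⟩ := hi 0
    obtain ⟨k, hk⟩ := hi 2
    refine ⟨_, ⟨m, -k, rfl⟩, ?_⟩
    rw [hf]
    ext i
    fin_cases i <;> simp <;> ring_nf <;> simp only [h2', h6'] <;> linarith

open MeasureTheory Set Real
open scoped ENNReal Pointwise

/-! Write `ω` for `sixthRoot`; in the complex plane `A₂` is `√2 ℤ[ω]`, of covolume `√3`. A code with
minimum distance at least `d ≤ √2` lifts to an `A₂`-periodic packing of the plane with the same
separation. Around each point cut the Voronoi cell off at radius `R = d/√3`. These truncated cells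
are disjoint and each has at least the area `√3/2 d²` of a regular hexagon
(`IsSeparatedFromZero.le_volumeReal_truncatedCell`), so comparing areas over one period gives `n d²
≤ 2` (`card_mul_sq_le_two`).

If `n d² = 2`, every cell has the hexagon's area, which forces six neighbours at distance exactly
`d`. Six such points form a regular hexagon (`mul_mem_of_ncard_eq_six`), and hexagons propagate, so
the packing is `p + v ℤ[ω]` (`exists_eq_setOf_sub_mem_hexagonal`). As `√2` is a period, `√2 = v γ`
with `γ ∈ ℤ[ω]` of norm `n`.

Conversely, `β ∈ ℤ[ω]` of norm `n` gives the code `√2 β⁻¹ ℤ[ω]` modulo `A₂`, a subgroup of order `n`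
with minimum distance at least `√(2/n)`; this meets the bound. The codes that meet it thus come from
elements of norm `n`. The condition on `n` says that only the ramified prime `3` and inert primes to
even powers occur, so that such an element exists and is unique up to units
(`hasUniqueEisensteinOfNorm`). Units preserve `ℤ[ω]`, hence all optimal codes are translates of a
single subgroup. -/

/-! ### Areas of circular sectors and segments -/

/-- The open circular sector, in the disk of radius `R` around `0`, that spans the arc of the circle
of radius `R` which is nearer to `q` than to `0`. -/
def diskSector (R : ℝ) (q : ℂ) : Set ℂ :=
  {x | ‖x‖ < R ∧ ‖x‖ * ‖q‖ ^ 2 < 2 * R * inner ℝ x q}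

/-- The circular segment of the points of the disk of radius `R` around `0` that are at least as
near to `q` as to `0`. -/
def diskCap (R : ℝ) (q : ℂ) : Set ℂ :=
  {x | ‖x‖ < R ∧ ‖q‖ ^ 2 ≤ 2 * inner ℝ x q}

lemma isOpen_diskSector (R : ℝ) (q : ℂ) : IsOpen (diskSector R q) :=
  (isOpen_lt (f := fun x : ℂ => ‖x‖) (g := fun _ => R) (by fun_prop) (by fun_prop)).inter
    (isOpen_lt (f := fun x : ℂ => ‖x‖ * ‖q‖ ^ 2) (g := fun x => 2 * R * inner ℝ x q)
      (by fun_prop) (by fun_prop))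

lemma measurableSet_diskCap (R : ℝ) (q : ℂ) : MeasurableSet (diskCap R q) :=
  (isOpen_lt (f := fun x : ℂ => ‖x‖) (g := fun _ => R)
      (by fun_prop) (by fun_prop)).measurableSet.inter
    (isClosed_le (f := fun _ : ℂ => ‖q‖ ^ 2) (g := fun x => 2 * inner ℝ x q)
      (by fun_prop) (by fun_prop)).measurableSet

lemma volume_preimage_rotation (u : Circle) (s : Set ℂ) :
    volume (rotation u ⁻¹' s) = volume s :=
  (rotation u).measurePreserving.measure_preimage_emb
    (rotation u).toHomeomorph.measurableEmbedding s

lemma exists_rotation_apply_norm (q : ℂ) : ∃ u : Circle, rotation u (‖q‖ : ℂ) = q :=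
  ⟨Circle.exp q.arg, by
    rw [rotation_apply, Circle.coe_exp, mul_comm, Complex.norm_mul_exp_arg_mul_I]⟩

lemma volume_diskSector_norm (R : ℝ) (q : ℂ) :
    volume (diskSector R q) = volume (diskSector R (‖q‖ : ℂ)) := by
  obtain ⟨u, hu⟩ := exists_rotation_apply_norm q
  rw [← volume_preimage_rotation u (diskSector R q)]
  congr 1
  ext x
  have h : inner ℝ (rotation u x) q = inner ℝ x (‖q‖ : ℂ) := by
    nth_rw 1 [← hu]
    exact (rotation u).inner_map_map _ _
  simp only [diskSector, mem_preimage, mem_ofPred_eq, h, LinearIsometryEquiv.norm_map]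
  simp

lemma volume_diskCap_norm (R : ℝ) (q : ℂ) :
    volume (diskCap R q) = volume (diskCap R (‖q‖ : ℂ)) := by
  obtain ⟨u, hu⟩ := exists_rotation_apply_norm q
  rw [← volume_preimage_rotation u (diskCap R q)]
  congr 1
  ext x
  have h : inner ℝ (rotation u x) q = inner ℝ x (‖q‖ : ℂ) := by
    nth_rw 1 [← hu]
    exact (rotation u).inner_map_map _ _
  simp only [diskCap, mem_preimage, mem_ofPred_eq, h, LinearIsometryEquiv.norm_map]
  simp

lemma inner_ofReal_right (x : ℂ) (a : ℝ) : inner ℝ x (a : ℂ) = a * x.re := by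
  simp [Complex.inner]

lemma mem_diskSector_ofReal {R a : ℝ} (ha : 0 < a) {x : ℂ} :
    x ∈ diskSector R (a : ℂ) ↔ ‖x‖ < R ∧ ‖x‖ * a < 2 * R * x.re := by
  simp only [diskSector, mem_ofPred_eq, inner_ofReal_right, Complex.norm_real, norm_eq_abs, sq_abs]
  refine and_congr_right fun _ => ?_
  rw [show ‖x‖ * a ^ 2 = ‖x‖ * a * a by ring, show 2 * R * (a * x.re) = 2 * R * x.re * a by ring,
    mul_lt_mul_iff_of_pos_right ha]

lemma mem_diskCap_ofReal {R a : ℝ} (ha : 0 < a) {x : ℂ} :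
    x ∈ diskCap R (a : ℂ) ↔ ‖x‖ < R ∧ a ≤ 2 * x.re := by
  simp only [diskCap, mem_ofPred_eq, inner_ofReal_right, Complex.norm_real, norm_eq_abs, sq_abs]
  refine and_congr_right fun _ => ?_
  rw [sq, show 2 * (a * x.re) = 2 * x.re * a by ring, mul_le_mul_iff_of_pos_right ha]

lemma volume_diskSector_two_mul_cos {R α : ℝ} (hR : 0 < R) (h0 : 0 < α) (h2 : α < π / 2) :
    volume (diskSector R ((2 * R * cos α : ℝ) : ℂ)) = ENNReal.ofReal (R ^ 2 * α) := by
  have hc : 0 < cos α := cos_pos_of_mem_Ioo ⟨by linarith, h2⟩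
  have hmeas := (isOpen_diskSector R ((2 * R * cos α : ℝ) : ℂ)).measurableSet
  rw [← lintegral_indicator_one hmeas, ← Complex.lintegral_comp_polarCoord_symm]
  have key : ∀ p ∈ polarCoord.target,
      ENNReal.ofReal p.1 • (diskSector R ((2 * R * cos α : ℝ) : ℂ)).indicator 1
        (Complex.polarCoord.symm p) =
      ((Ioo 0 R).indicator (fun r => ENNReal.ofReal r) p.1) *
        ((Ioo (-α) α).indicator (fun _ => (1 : ℝ≥0∞)) p.2) := by
    rintro ⟨r, φ⟩ ⟨hr, hφ⟩
    simp only [mem_Ioi, mem_Ioo] at hr hφ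
    have hmem : Complex.polarCoord.symm (r, φ) ∈ diskSector R ((2 * R * cos α : ℝ) : ℂ) ↔
        r ∈ Ioo 0 R ∧ φ ∈ Ioo (-α) α := by
      rw [mem_diskSector_ofReal (by positivity), Complex.norm_polarCoord_symm, abs_of_pos hr]
      have hre : (Complex.polarCoord.symm (r, φ)).re = r * cos φ := by
        simp [Complex.cos_ofReal_re, Complex.sin_ofReal_im]
      rw [hre, mem_Ioo, mem_Ioo, ← abs_lt]
      simp only [hr, true_and]
      refine and_congr_right fun _ => ?_
      rw [← cos_abs φ]
      have e : r * (2 * R * cos α) < 2 * R * (r * cos |φ|) ↔ cos α < cos |φ| := by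
        rw [show r * (2 * R * cos α) = (2 * R * r) * cos α by ring,
          show 2 * R * (r * cos |φ|) = (2 * R * r) * cos |φ| by ring,
          mul_lt_mul_iff_of_pos_left (by positivity)]
      rw [e]
      exact strictAntiOn_cos.lt_iff_gt ⟨h0.le, by linarith⟩
        ⟨abs_nonneg _, (abs_lt.2 hφ).le⟩
    by_cases h1 : r ∈ Ioo 0 R <;> by_cases h2 : φ ∈ Ioo (-α) α <;>
      simp only [indicator, hmem, h1, h2, and_self, and_true, and_false, if_true, if_false,
        Pi.one_apply, smul_eq_mul, mul_one, mul_zero]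
  rw [setLIntegral_congr_fun polarCoord.open_target.measurableSet key]
  rw [polarCoord_target, Measure.volume_eq_prod, ← Measure.prod_restrict, lintegral_prod_mul]
  · rw [setLIntegral_indicator measurableSet_Ioo, setLIntegral_indicator measurableSet_Ioo]
    have e1 : Ioo 0 R ∩ Ioi 0 = Ioo 0 R := by ext; simp; grind
    have e2 : Ioo (-α) α ∩ Ioo (-π) π = Ioo (-α) α := by
      have := pi_pos
      apply inter_eq_left.2
      exact Ioo_subset_Ioo (by linarith) (by linarith)
    rw [e1, e2, setLIntegral_const, Real.volume_Ioo, one_mul]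
    rw [← ofReal_integral_eq_lintegral_ofReal]
    · rw [← integral_Ioc_eq_integral_Ioo, ← intervalIntegral.integral_of_le hR.le, integral_id,
        ← ENNReal.ofReal_mul (by nlinarith [sq_nonneg R])]
      congr 1; ring
    · exact (continuous_id.integrableOn_Icc (a := 0) (b := R)).mono_set Ioo_subset_Icc_self
    · exact (ae_restrict_iff' measurableSet_Ioo).2 (.of_forall fun x hx => hx.1.le)
  · exact (ENNReal.measurable_ofReal.indicator measurableSet_Ioo).aemeasurable
  · exact (measurable_const.indicator measurableSet_Ioo).aemeasurable

/-- Removing the segment from its sector leaves an isosceles triangle with apex `0` and half-angle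
`α`, bounded by the chord at real part `R cos α`. The segment's area is then sector minus triangle.
-/
lemma diskSector_diff_diskCap {R α : ℝ} (hR : 0 < R) (h0 : 0 < α) (h2 : α < π / 2) :
    diskSector R ((2 * R * cos α : ℝ) : ℂ) \ diskCap R ((2 * R * cos α : ℝ) : ℂ) =
      Complex.measurableEquivRealProd ⁻¹'
        regionBetween (fun x => -(tan α * x)) (fun x => tan α * x) (Ioo 0 (R * cos α)) := by
  have hc : 0 < cos α := cos_pos_of_mem_Ioo ⟨by linarith, h2⟩
  ext x
  have ha : 0 < 2 * R * cos α := by positivity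
  rw [mem_sdiff, mem_diskSector_ofReal ha, mem_diskCap_ofReal ha]
  simp only [regionBetween, mem_preimage, mem_ofPred_eq, Complex.measurableEquivRealProd_apply,
    mem_Ioo, ← abs_lt]
  have hsq : ‖x‖ ^ 2 = x.re ^ 2 + x.im ^ 2 := by rw [Complex.sq_norm, Complex.normSq_apply]; ring
  have key : ‖x‖ * (2 * R * cos α) < 2 * R * x.re ↔ 0 < x.re ∧ |x.im| < tan α * x.re := by
    have e1 : ‖x‖ * (2 * R * cos α) < 2 * R * x.re ↔ ‖x‖ * cos α < x.re := by
      rw [show ‖x‖ * (2 * R * cos α) = (2 * R) * (‖x‖ * cos α) by ring,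
          mul_lt_mul_iff_of_pos_left (by positivity)]
    have hs : 0 < sin α := sin_pos_of_pos_of_lt_pi h0 (by linarith [pi_pos])
    have e2 : |x.im| < tan α * x.re ↔ cos α * |x.im| < sin α * x.re := by
      rw [tan_eq_sin_div_cos, div_mul_eq_mul_div, lt_div_iff₀ hc, mul_comm]
    rw [e1, e2]
    have e3 : 0 < x.re → (‖x‖ * cos α < x.re ↔ cos α * |x.im| < sin α * x.re) := by
      intro h
      rw [← pow_lt_pow_iff_left₀ (by positivity) h.le two_ne_zero,
        ← pow_lt_pow_iff_left₀ (a := cos α * |x.im|) (by positivity) (by positivity) two_ne_zero,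
        mul_pow, mul_pow, mul_pow, hsq, sq_abs, sin_sq]
      constructor <;> intro h <;> nlinarith
    constructor
    · intro h
      have : 0 < x.re := lt_of_le_of_lt (by positivity) h
      exact ⟨this, (e3 this).1 h⟩
    · rintro ⟨h, h'⟩
      exact (e3 h).2 h'
  rw [key]
  constructor
  · rintro ⟨⟨h1, h2, h3⟩, h4⟩
    refine ⟨⟨h2, ?_⟩, h3⟩
    by_contra! h
    exact h4 ⟨h1, by linarith⟩
  · rintro ⟨⟨h1, h2⟩, h3⟩
    refine ⟨⟨?_, h1, h3⟩, fun h => by linarith [h.2]⟩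
    have := key.2 ⟨h1, h3⟩
    have h5 : (2 * R * cos α) * ‖x‖ < (2 * R * cos α) * R := by nlinarith
    exact (mul_lt_mul_iff_of_pos_left ha).1 h5

lemma volume_diskSector_diff_diskCap {R α : ℝ} (hR : 0 < R) (h0 : 0 < α) (h2 : α < π / 2) :
    volume (diskSector R ((2 * R * cos α : ℝ) : ℂ) \ diskCap R ((2 * R * cos α : ℝ) : ℂ)) =
      ENNReal.ofReal (R ^ 2 * (sin α * cos α)) := by
  have hc : 0 < cos α := cos_pos_of_mem_Ioo ⟨by linarith, h2⟩
  have hs : 0 < sin α := sin_pos_of_pos_of_lt_pi h0 (by linarith [pi_pos])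
  have ht : 0 < tan α := tan_pos_of_pos_of_lt_pi_div_two h0 h2
  rw [diskSector_diff_diskCap hR h0 h2,
    Complex.volume_preserving_equiv_real_prod.measure_preimage_equiv, Measure.volume_eq_prod,
    volume_regionBetween_eq_integral]
  · congr 1
    have : (fun x : ℝ => ((fun x => tan α * x) - fun x => -(tan α * x)) x) =
        fun x => (2 * tan α) * x := by funext x; simp; ring
    rw [this, ← integral_Ioc_eq_integral_Ioo,
      ← intervalIntegral.integral_of_le (by positivity), intervalIntegral.integral_const_mul,
      integral_id, tan_eq_sin_div_cos]
    field_simp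
    ring
  · exact ((by fun_prop : Continuous fun x => -(tan α * x)).integrableOn_Icc
      (a := 0) (b := R * cos α)).mono_set Ioo_subset_Icc_self
  · exact ((by fun_prop : Continuous fun x => tan α * x).integrableOn_Icc
      (a := 0) (b := R * cos α)).mono_set Ioo_subset_Icc_self
  · exact measurableSet_Ioo
  · intro x hx
    have := mul_pos ht hx.1
    linarith

lemma diskCap_subset_diskSector {R : ℝ} {q : ℂ} (hq : q ≠ 0) : diskCap R q ⊆ diskSector R q := by
  rintro x ⟨h1, h2⟩
  have : 0 < ‖q‖ := norm_pos_iff.2 hq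
  refine ⟨h1, ?_⟩
  have hR : 0 < R := (norm_nonneg x).trans_lt h1
  nlinarith [mul_le_mul_of_nonneg_left h2 hR.le, mul_lt_mul_of_pos_right h1 (pow_pos this 2)]

/-- The area of a sector of half-angle `α`. -/
lemma volumeReal_diskSector {R α : ℝ} {q : ℂ} (hR : 0 < R) (h0 : 0 < α) (h2 : α < π / 2)
    (hq : ‖q‖ = 2 * R * cos α) : volume.real (diskSector R q) = R ^ 2 * α := by
  rw [Measure.real, volume_diskSector_norm, hq, volume_diskSector_two_mul_cos hR h0 h2,
    ENNReal.toReal_ofReal (by positivity)]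

/-- The area of a circular segment of half-angle `α`. -/
lemma volumeReal_diskCap {R α : ℝ} {q : ℂ} (hR : 0 < R) (h0 : 0 < α) (h2 : α < π / 2)
    (hq : ‖q‖ = 2 * R * cos α) :
    volume.real (diskCap R q) = R ^ 2 * (α - sin α * cos α) := by
  have hc : 0 < cos α := cos_pos_of_mem_Ioo ⟨by linarith, h2⟩
  have hs : 0 < sin α := sin_pos_of_pos_of_lt_pi h0 (by linarith [pi_pos])
  have hfin : volume (diskSector R ((2 * R * cos α : ℝ) : ℂ)) ≠ ⊤ := by
    rw [volume_diskSector_two_mul_cos hR h0 h2]; exact ENNReal.ofReal_ne_top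
  have hsub : diskCap R ((2 * R * cos α : ℝ) : ℂ) ⊆ diskSector R ((2 * R * cos α : ℝ) : ℂ) :=
    diskCap_subset_diskSector (by
      rw [Ne, Complex.ofReal_eq_zero]; positivity)
  have h := measureReal_sdiff (μ := volume) hsub (measurableSet_diskCap R _) hfin
  simp only [Measure.real, volume_diskSector_diff_diskCap hR h0 h2,
    volume_diskSector_two_mul_cos hR h0 h2] at h
  rw [ENNReal.toReal_ofReal (by positivity), ENNReal.toReal_ofReal (by positivity)] at h
  rw [Measure.real, volume_diskCap_norm, hq]
  linarith

/-! ### The area of a truncated Voronoi cell -/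

lemma Set.finite_of_isBounded_of_pairwise_le_dist {X : Type*} [PseudoMetricSpace X] [ProperSpace X]
    {s : Set X} (hs : Bornology.IsBounded s) {d : ℝ} (hd : 0 < d)
    (h : s.Pairwise fun x y => d ≤ dist x y) : s.Finite := by
  obtain ⟨t, ht, hst⟩ := Metric.totallyBounded_iff.1 (hs.isCompact_closure.totallyBounded.subset
    subset_closure) (d / 2) (by positivity)
  have key : ∀ x ∈ s, ∃ y ∈ t, dist x y < d / 2 := fun x hx => by simpa using hst hx
  choose! f hft hf using key
  refine Set.Finite.of_finite_image (f := f) (ht.subset (image_subset_iff.2 hft)) ?_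
  intro x hx y hy hxy
  by_contra hne
  have := h hx hy hne
  have h1 := hf x hx
  have h2 := hf y hy
  rw [← hxy, dist_comm] at h2
  linarith [dist_triangle x (f x) y]

/-- For a common point `x`, the point `y = R x/‖x‖` has distance `R` from `0` and less than `R` from
`q` and `q'`. But the squared distances from `y` to three points sum to at least a third of the sum
of their squared mutual distances, here at least `3R²`. -/
lemma disjoint_diskSector {R : ℝ} {q q' : ℂ} (hq : 3 * R ^ 2 ≤ ‖q‖ ^ 2)
    (hq' : 3 * R ^ 2 ≤ ‖q'‖ ^ 2) (hqq' : 3 * R ^ 2 ≤ ‖q - q'‖ ^ 2) :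
    Disjoint (diskSector R q) (diskSector R q') := by
  rw [Set.disjoint_left]
  rintro x ⟨hx, h1⟩ ⟨-, h2⟩
  have hr : 0 < ‖x‖ := by
    rw [norm_pos_iff]
    rintro rfl
    simp at h1
  have hR : 0 < R := hr.trans hx
  have hc : inner ℝ x x = ‖x‖ ^ 2 := real_inner_self_eq_norm_sq x
  have hA : inner ℝ q q = ‖q‖ ^ 2 := real_inner_self_eq_norm_sq q
  have hB : inner ℝ q' q' = ‖q'‖ ^ 2 := real_inner_self_eq_norm_sq q'
  have hC : ‖q - q'‖ ^ 2 = ‖q‖ ^ 2 - 2 * inner ℝ q q' + ‖q'‖ ^ 2 := norm_sub_sq_real q q'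
  -- The vector is `3‖x‖ (g - y)`, where `g = (q + q')/3` is the centroid of `0`, `q`, `q'` and `y =
  -- R x/‖x‖`.
  have h0 : 0 ≤ inner ℝ (‖x‖ • (q + q') - (3 * R) • x) (‖x‖ • (q + q') - (3 * R) • x) :=
    real_inner_self_nonneg
  simp only [inner_sub_left, inner_sub_right, inner_add_left, inner_add_right, inner_smul_left,
    inner_smul_right, real_inner_comm x, real_inner_comm q q', conj_trivial, hc, hA, hB] at h0
  nlinarith [mul_lt_mul_of_pos_left (add_lt_add h1 h2) hr, pow_pos hr 2,
    mul_le_mul_of_nonneg_left hq (pow_pos hr 2).le, mul_le_mul_of_nonneg_left hq' (pow_pos hr 2).le,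
    mul_le_mul_of_nonneg_left hqq' (pow_pos hr 2).le]

/-- By strict concavity, `sin` lies above its chord over `[0, π/3]`. -/
lemma mul_lt_sin_of_lt_pi_div_three {x : ℝ} (h0 : 0 < x) (h1 : x < π / 3) :
    3 * √3 / (2 * π) * x < sin x := by
  have hpi := pi_pos
  have hm0 : (0 : ℝ) ∈ Icc 0 π := ⟨le_rfl, hpi.le⟩
  have hm1 : π / 3 ∈ Icc 0 π := ⟨by positivity, by linarith⟩
  have hb : 0 < 1 - x / (π / 3) := by rw [sub_pos, div_lt_one (by positivity)]; exact h1
  have h := strictConcaveOn_sin_Icc.2 hm0 hm1 (ne_of_lt (by positivity)) hb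
    (by positivity : 0 < x / (π / 3)) (by ring)
  simp only [smul_eq_mul, sin_zero, sin_pi_div_three, mul_zero, zero_add] at h
  rw [div_mul_cancel₀ _ (by positivity)] at h
  have e : 3 * √3 / (2 * π) * x = x / (π / 3) * (√3 / 2) := by field_simp
  rwa [e]

/-- The part of the disk of radius `R` around `0` of the points that are nearer to `0` than to any
point of `Q`: a truncated Voronoi cell. -/
def truncatedCell (R : ℝ) (Q : Set ℂ) : Set ℂ :=
  {x | ‖x‖ < R ∧ ∀ q ∈ Q, 2 * inner ℝ x q < ‖q‖ ^ 2}

/-- A point of norm at least `2R` has its bisector outside the open disk and cuts nothing off, so in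
a packing only finitely many segments matter. -/
lemma truncatedCell_eq_sdiff {R : ℝ} (Q : Set ℂ) :
    truncatedCell R Q = Metric.ball 0 R \ ⋃ q ∈ {q ∈ Q | ‖q‖ < 2 * R}, diskCap R q := by
  ext x
  simp only [truncatedCell, diskCap, mem_ofPred_eq, mem_sdiff, mem_ball_zero_iff, mem_iUnion,
    not_exists, not_and, not_le]
  refine and_congr_right fun hx => ⟨fun h q hq _ => h q hq.1, fun h q hq => ?_⟩
  by_cases h2 : ‖q‖ < 2 * R
  · exact h q ⟨hq, h2⟩ hx
  · have hR : 0 < R := (norm_nonneg x).trans_lt hx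
    have := real_inner_le_norm x q
    nlinarith

/-- Together with `0`, the set `Q` forms a packing with mutual distances of at least `√3 R`. -/
structure IsSeparatedFromZero (R : ℝ) (Q : Set ℂ) : Prop where
  le_norm : ∀ q ∈ Q, 3 * R ^ 2 ≤ ‖q‖ ^ 2
  le_norm_sub : ∀ q ∈ Q, ∀ q' ∈ Q, q ≠ q' → 3 * R ^ 2 ≤ ‖q - q'‖ ^ 2

lemma IsSeparatedFromZero.finite {R : ℝ} {Q : Set ℂ} (hQ : IsSeparatedFromZero R Q) (hR : 0 < R) :
    {q ∈ Q | ‖q‖ < 2 * R}.Finite := by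
  refine Set.finite_of_isBounded_of_pairwise_le_dist
    (Metric.isBounded_ball.subset fun q hq => mem_ball_zero_iff.2 hq.2) hR ?_
  intro q hq q' hq' hne
  rw [dist_eq_norm]
  refine abs_le_of_sq_le_sq' ?_ (norm_nonneg _) |>.2
  nlinarith [hQ.le_norm_sub q hq.1 q' hq'.1 hne]

lemma IsSeparatedFromZero.measurableSet_truncatedCell {R : ℝ} {Q : Set ℂ}
    (hQ : IsSeparatedFromZero R Q) (hR : 0 < R) : MeasurableSet (truncatedCell R Q) := by
  rw [truncatedCell_eq_sdiff]
  exact measurableSet_ball.diff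
    ((hQ.finite hR).measurableSet_biUnion fun q _ => measurableSet_diskCap R q)

lemma volume_truncatedCell_ne_top (R : ℝ) (Q : Set ℂ) : volume (truncatedCell R Q) ≠ ⊤ :=
  measure_ne_top_of_subset (fun _ hx => mem_ball_zero_iff.2 hx.1)
    (measure_ball_lt_top (x := (0 : ℂ)) (r := R)).ne

lemma arccos_norm_div_mem {R : ℝ} (hR : 0 < R) {q : ℂ} (h : 3 * R ^ 2 ≤ ‖q‖ ^ 2)
    (h2 : ‖q‖ < 2 * R) :
    0 < arccos (‖q‖ / (2 * R)) ∧ arccos (‖q‖ / (2 * R)) ≤ π / 6 ∧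
      ‖q‖ = 2 * R * cos (arccos (‖q‖ / (2 * R))) := by
  have hlt : ‖q‖ / (2 * R) < 1 := (div_lt_one (by positivity)).2 h2
  refine ⟨arccos_pos.2 hlt, ?_, ?_⟩
  · have hpi := pi_pos
    rw [← arccos_cos (x := π / 6) (by positivity) (by linarith), cos_pi_div_six]
    refine arccos_le_arccos ?_
    rw [div_le_div_iff₀ (by positivity) (by positivity)]
    have h3 : √3 ^ 2 = 3 := Real.sq_sqrt (by norm_num)
    have : √3 * R ≤ ‖q‖ := by
      refine (abs_le_of_sq_le_sq' ?_ (norm_nonneg _)).2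
      rw [mul_pow, h3]; exact h
    linarith
  · rw [cos_arccos (by have := norm_nonneg q; have : 0 ≤ ‖q‖ / (2 * R) := by positivity
                       linarith) hlt.le]
    field_simp

/-- The truncated Voronoi cell of a point in a planar packing has at least the area of the regular
hexagon, and if equality holds then the point has six nearest neighbours. -/
theorem IsSeparatedFromZero.le_volumeReal_truncatedCell {R : ℝ} {Q : Set ℂ}
    (hQ : IsSeparatedFromZero R Q) (hR : 0 < R) :
    3 * √3 / 2 * R ^ 2 ≤ volume.real (truncatedCell R Q) ∧
      (volume.real (truncatedCell R Q) = 3 * √3 / 2 * R ^ 2 →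
        {q ∈ Q | ‖q‖ ^ 2 = 3 * R ^ 2}.ncard = 6) := by
  have hfin := hQ.finite hR
  set F := hfin.toFinset with hF
  have hpi := pi_pos
  have hmem : ∀ q ∈ F, q ∈ Q ∧ ‖q‖ < 2 * R := fun q hq => by simpa [hF] using hq
  set α : ℂ → ℝ := fun q => arccos (‖q‖ / (2 * R)) with hα
  have hα' : ∀ q ∈ F, 0 < α q ∧ α q ≤ π / 6 ∧ ‖q‖ = 2 * R * cos (α q) := fun q hq =>
    arccos_norm_div_mem hR (hQ.le_norm q (hmem q hq).1) (hmem q hq).2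
  have hball : volume.real (Metric.ball (0 : ℂ) R) = π * R ^ 2 := by
    rw [Measure.real, Complex.volume_ball]
    simp [hR.le, mul_comm]
  have hballfin : volume (Metric.ball (0 : ℂ) R) ≠ ⊤ := measure_ball_lt_top.ne
  -- The sectors are disjoint inside the disk: the half-angles sum to at most `π`.
  have hsector : ∑ q ∈ F, R ^ 2 * α q ≤ π * R ^ 2 := by
    have hsub : (⋃ q ∈ F, diskSector R q) ⊆ Metric.ball 0 R :=
      iUnion₂_subset fun q _ x hx => mem_ball_zero_iff.2 hx.1
    have h1 := measureReal_mono hsub hballfin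
    rw [measureReal_biUnion_finset ?_ (fun q _ => (isOpen_diskSector R q).measurableSet) ?_,
      hball] at h1
    · rwa [Finset.sum_congr rfl fun q hq => volumeReal_diskSector hR (hα' q hq).1
        (by linarith [(hα' q hq).2.1]) (hα' q hq).2.2] at h1
    · intro q hq q' hq' hne
      exact disjoint_diskSector (hQ.le_norm q (hmem q hq).1) (hQ.le_norm q' (hmem q' hq').1)
        (hQ.le_norm_sub q (hmem q hq).1 q' (hmem q' hq').1 hne)
    · exact fun q _ => measure_ne_top_of_subset (fun _ hx => mem_ball_zero_iff.2 hx.1) hballfin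
  have hcell : π * R ^ 2 - ∑ q ∈ F, R ^ 2 * (α q - sin (α q) * cos (α q)) ≤
      volume.real (truncatedCell R Q) := by
    have hU : (⋃ q ∈ {q ∈ Q | ‖q‖ < 2 * R}, diskCap R q) = ⋃ q ∈ F, diskCap R q := by
      simp [hF]
    have hsub : (⋃ q ∈ F, diskCap R q) ⊆ Metric.ball 0 R :=
      iUnion₂_subset fun q _ x hx => mem_ball_zero_iff.2 hx.1
    rw [truncatedCell_eq_sdiff, hU, measureReal_sdiff hsub
      (F.measurableSet_biUnion fun q _ => measurableSet_diskCap R q) hballfin, hball]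
    have := measureReal_biUnion_finset_le (μ := (volume : Measure ℂ)) F (diskCap R)
    rw [Finset.sum_congr rfl fun q hq => volumeReal_diskCap hR (hα' q hq).1
        (by linarith [(hα' q hq).2.1]) (hα' q hq).2.2] at this
    linarith
  -- The slope of the chord of `sin` over `[0, π/3]`, and also the ratio of the area of the
  -- inscribed regular hexagon to that of the disk. Each segment takes up at most the fraction `1 -
  -- c` of its sector, so the cell keeps at least the fraction `c` of the disk.
  set c := 3 * √3 / (2 * π) with hc
  have hcpi : c * π = 3 * √3 / 2 := by rw [hc]; field_simp
  have hc1 : c < 1 := by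
    rw [hc, div_lt_one (by positivity)]
    have : √3 < 1.8 := by
      rw [Real.sqrt_lt' (by norm_num)]; norm_num
    linarith [pi_gt_three]
  have hlt : ∀ q ∈ F, α q ≠ π / 6 → c * α q < sin (α q) * cos (α q) := fun q hq hne => by
    have h1 := mul_lt_sin_of_lt_pi_div_three (x := 2 * α q) (by linarith [(hα' q hq).1])
      (by have := lt_of_le_of_ne (hα' q hq).2.1 hne; linarith)
    rw [sin_two_mul] at h1
    linarith
  have heq : c * (π / 6) = sin (π / 6) * cos (π / 6) := by
    rw [sin_pi_div_six, cos_pi_div_six]; linarith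
  have hle : ∀ q ∈ F, c * α q ≤ sin (α q) * cos (α q) := fun q hq => by
    by_cases h : α q = π / 6
    · rw [h]; exact heq.le
    · exact (hlt q hq h).le
  have hsum : ∑ q ∈ F, R ^ 2 * (α q - sin (α q) * cos (α q)) ≤ (1 - c) * ∑ q ∈ F, R ^ 2 * α q := by
    rw [Finset.mul_sum]
    refine Finset.sum_le_sum fun q hq => ?_
    nlinarith [hle q hq, pow_pos hR 2, mul_le_mul_of_nonneg_left (hle q hq) (pow_pos hR 2).le]
  have hmul := mul_le_mul_of_nonneg_left hsector (sub_nonneg.2 hc1.le)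
  have hRR : c * π * R ^ 2 = 3 * √3 / 2 * R ^ 2 := by rw [hcpi]
  refine ⟨by linarith, fun hE => ?_⟩
  -- In the case of equality the chord estimate must be sharp at every `q`, which happens only at `α
  -- = π/6`, that is, `‖q‖ = √3 R`. Since the half-angles then sum to exactly `π`, there are six of
  -- them.
  have h6 : ∀ q ∈ F, α q = π / 6 := by
    by_contra! hcon
    obtain ⟨q₀, hq₀, hne⟩ := hcon
    have : ∑ q ∈ F, R ^ 2 * (α q - sin (α q) * cos (α q)) <
        (1 - c) * ∑ q ∈ F, R ^ 2 * α q := by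
      rw [Finset.mul_sum]
      refine Finset.sum_lt_sum (fun q hq => ?_) ⟨q₀, hq₀, ?_⟩
      · nlinarith [mul_le_mul_of_nonneg_left (hle q hq) (pow_pos hR 2).le]
      · nlinarith [mul_lt_mul_of_pos_left (hlt q₀ hq₀ hne) (pow_pos hR 2)]
    linarith
  have hFeq : {q ∈ Q | ‖q‖ ^ 2 = 3 * R ^ 2} = (F : Set ℂ) := by
    ext q
    simp only [hF, mem_ofPred_eq, Finite.coe_toFinset]
    refine and_congr_right fun hq => ⟨fun h => ?_, fun h => ?_⟩
    · refine lt_of_pow_lt_pow_left₀ 2 (by positivity) ?_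
      nlinarith [pow_pos hR 2]
    · have hqF : q ∈ F := by simp [hF, hq, h]
      have h3 : √3 ^ 2 = 3 := Real.sq_sqrt (by norm_num)
      rw [(hα' q hqF).2.2, h6 q hqF, cos_pi_div_six]
      linear_combination (R ^ 2) * h3
  rw [hFeq, ncard_coe_finset]
  have hs2 : ∑ q ∈ F, R ^ 2 * α q = π * R ^ 2 := by
    have : (1 - c) * (π * R ^ 2) ≤ (1 - c) * ∑ q ∈ F, R ^ 2 * α q := by linarith
    exact le_antisymm hsector ((mul_le_mul_iff_of_pos_left (sub_pos.2 hc1)).1 this)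
  rw [Finset.sum_congr rfl fun q hq => by rw [h6 q hq], Finset.sum_const, nsmul_eq_mul] at hs2
  have h7 : (F.card : ℝ) * (R ^ 2 * π) = 6 * (R ^ 2 * π) := by linarith
  exact_mod_cast mul_right_cancel₀ (by positivity) h7

/-! ### Six points on a circle form a regular hexagon -/

/-- On the unit circle `w² - 2 Re(w) w + 1 = 0`. For real part `±1/2` this quadratic divides `w⁶ -
1`; for `±1` it is the square of a linear factor of it. -/
lemma Complex.pow_six_eq_one_of_norm_eq_one {w : ℂ} (hw : ‖w‖ = 1)
    (h : w.re = 1 ∨ w.re = 1 / 2 ∨ w.re = -1 / 2 ∨ w.re = -1) : w ^ 6 = 1 := by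
  have hn : w.re * w.re + w.im * w.im = 1 := by
    rw [← Complex.normSq_apply, Complex.normSq_eq_norm_sq, hw]; norm_num
  have hq : w ^ 2 = 2 * (w.re : ℂ) * w - 1 := by
    apply Complex.ext
    · simp [pow_two]; linarith
    · simp [pow_two]; ring
  rcases h with h | h | h | h <;> rw [h] at hq <;> push_cast at hq
  · have : (w - 1) ^ 2 = 0 := by linear_combination hq
    rw [sub_eq_zero.1 (pow_eq_zero_iff two_ne_zero |>.1 this), one_pow]
  · linear_combination (w ^ 4 + w ^ 3 - w - 1) * hq
  · linear_combination (w ^ 4 - w ^ 3 + w - 1) * hq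
  · have : (w + 1) ^ 2 = 0 := by linear_combination hq
    rw [eq_neg_of_add_eq_zero_left (pow_eq_zero_iff two_ne_zero |>.1 this)]; norm_num

/-- The double sum is `|∑ u^k|²`. This is the positive definiteness of the Chebyshev polynomials on
the circle. -/
lemma Complex.sum_sum_re_pow_nonneg (N : Finset ℂ) (k : ℕ) :
    0 ≤ ∑ u ∈ N, ∑ v ∈ N, ((u * (starRingEnd ℂ) v) ^ k).re := by
  have h : (∑ u ∈ N, ∑ v ∈ N, ((u * (starRingEnd ℂ) v) ^ k).re) =
      Complex.normSq (∑ u ∈ N, u ^ k) := by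
    rw [← Complex.ofReal_re (Complex.normSq _), ← Complex.mul_conj, map_sum, Finset.sum_mul_sum,
      Complex.re_sum]
    refine Finset.sum_congr rfl fun u _ => ?_
    rw [Complex.re_sum]
    refine Finset.sum_congr rfl fun v _ => ?_
    rw [mul_pow, map_pow]
  rw [h]
  exact Complex.normSq_nonneg _

/-- Six unit vectors at mutual angles of at least `π / 3` differ by sixth roots of unity: the linear
programming bound for the kissing number of the plane is attained. -/
lemma pow_six_eq_one_of_card_eq_six {N : Finset ℂ} (hcard : N.card = 6)
    (h1 : ∀ u ∈ N, ‖u‖ = 1) (h2 : ∀ u ∈ N, ∀ v ∈ N, u ≠ v → 1 ≤ ‖u - v‖)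
    {u v : ℂ} (hu : u ∈ N) (hv : v ∈ N) : (u / v) ^ 6 = 1 := by
  -- The Delsarte polynomial for the regular hexagon: it vanishes at the cosines `1/2`, `-1/2`, `-1`
  -- between distinct vertices, and the double root keeps it nonpositive on `[-1, 1/2]`. Its
  -- Chebyshev coefficients, listed in `hexp`, are positive.
  set f : ℝ → ℝ := fun t => (t - 1 / 2) * (t + 1 / 2) ^ 2 * (t + 1) with hf
  set t : ℂ → ℂ → ℝ := fun u v => (u * (starRingEnd ℂ) v).re with ht
  have hnorm : ∀ u ∈ N, ∀ v ∈ N, ‖u * (starRingEnd ℂ) v‖ = 1 := fun u hu v hv => by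
    rw [norm_mul, Complex.norm_conj, h1 u hu, h1 v hv, one_mul]
  have hexp : ∀ u ∈ N, ∀ v ∈ N, f (t u v) = 3 / 8 + 3 / 4 * ((u * (starRingEnd ℂ) v) ^ 1).re +
      5 / 8 * ((u * (starRingEnd ℂ) v) ^ 2).re + 3 / 8 * ((u * (starRingEnd ℂ) v) ^ 3).re +
      1 / 8 * ((u * (starRingEnd ℂ) v) ^ 4).re := fun u hu v hv => by
    have hw := hnorm u hu v hv
    simp only [hf, ht]
    generalize u * (starRingEnd ℂ) v = w at hw
    have hn : w.im * w.im = 1 - w.re * w.re := by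
      have : w.re * w.re + w.im * w.im = 1 := by
        rw [← Complex.normSq_apply, Complex.normSq_eq_norm_sq, hw]; norm_num
      linarith
    have e2 : (w ^ 2).re = 2 * w.re ^ 2 - 1 := by
      simp only [pow_succ, pow_zero, one_mul, Complex.mul_re]; linarith
    have i2 : (w ^ 2).im = 2 * w.re * w.im := by
      simp only [pow_succ, pow_zero, one_mul, Complex.mul_im]; ring
    have e3 : (w ^ 3).re = 4 * w.re ^ 3 - 3 * w.re := by
      rw [pow_succ, Complex.mul_re, e2, i2]; linear_combination (-2 * w.re) * hn
    have e4 : (w ^ 4).re = 8 * w.re ^ 4 - 8 * w.re ^ 2 + 1 := by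
      rw [show w ^ 4 = w ^ 2 * w ^ 2 by ring, Complex.mul_re, e2, i2]
      linear_combination (-4 * w.re ^ 2) * hn
    rw [pow_one, e2, e3, e4]; ring
  -- `27/2 = 36 · 3/8` is the contribution of the constant term. It equals the diagonal contribution
  -- `6 · f(1) = 6 · 9/4`, so the nonpositive off-diagonal terms must all vanish.
  have hsum : 27 / 2 ≤ ∑ u ∈ N, ∑ v ∈ N, f (t u v) := by
    rw [Finset.sum_congr rfl fun u hu => Finset.sum_congr rfl fun v hv => hexp u hu v hv]
    simp only [Finset.sum_add_distrib, ← Finset.mul_sum, Finset.sum_const, hcard, nsmul_eq_mul]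
    have p1 := Complex.sum_sum_re_pow_nonneg N 1
    have p2 := Complex.sum_sum_re_pow_nonneg N 2
    have p3 := Complex.sum_sum_re_pow_nonneg N 3
    have p4 := Complex.sum_sum_re_pow_nonneg N 4
    push_cast
    linarith
  have htu : ∀ u ∈ N, t u u = 1 := fun u hu => by
    simp only [ht]
    rw [Complex.mul_conj, Complex.ofReal_re, Complex.normSq_eq_norm_sq, h1 u hu, one_pow]
  have hle : ∀ u ∈ N, ∀ v ∈ N, u ≠ v → f (t u v) ≤ 0 := fun u hu v hv huv => by
    have ha : t u v ≤ 1 / 2 := by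
      have h3 := h2 u hu v hv huv
      have h4 : ‖u - v‖ ^ 2 = 1 - 2 * t u v + 1 := by
        rw [← Complex.normSq_eq_norm_sq, Complex.normSq_sub, Complex.normSq_eq_norm_sq,
          Complex.normSq_eq_norm_sq, h1 u hu, h1 v hv]
        ring
      nlinarith
    have hb : -1 ≤ t u v := by
      have := Complex.abs_re_le_norm (u * (starRingEnd ℂ) v)
      rw [hnorm u hu v hv] at this
      exact (abs_le.1 this).1
    simp only [hf]
    have := mul_nonneg (mul_nonneg (sub_nonneg.2 ha) (sq_nonneg (t u v + 1 / 2)))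
      (by linarith : 0 ≤ t u v + 1)
    linarith
  have hle' : ∀ u ∈ N, ∀ v ∈ N, f (t u v) ≤ if u = v then 9 / 4 else 0 := fun u hu v hv => by
    split_ifs with h
    · rw [← h, htu u hu]; norm_num [hf]
    · exact hle u hu v hv h
  have hzero : ∀ u ∈ N, ∀ v ∈ N, u ≠ v → f (t u v) = 0 := by
    by_contra! hcon
    obtain ⟨u, hu, v, hv, huv, hne⟩ := hcon
    have hlt := lt_of_le_of_ne (hle u hu v hv huv) hne
    have h3 : ∑ u ∈ N, ∑ v ∈ N, f (t u v) < ∑ u ∈ N, ∑ v ∈ N, if u = v then 9 / 4 else 0 := by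
      refine Finset.sum_lt_sum (fun u hu => Finset.sum_le_sum (hle' u hu)) ⟨u, hu, ?_⟩
      refine Finset.sum_lt_sum (hle' u hu) ⟨v, hv, ?_⟩
      rwa [if_neg huv]
    simp only [Finset.sum_ite_eq, Finset.sum_ite_mem, Finset.inter_self, Finset.sum_const, hcard,
      nsmul_eq_mul] at h3
    norm_num at h3
    linarith
  have hv0 : v ≠ 0 := by rw [← norm_ne_zero_iff, h1 v hv]; exact one_ne_zero
  by_cases huv : u = v
  · rw [huv, div_self hv0, one_pow]
  have hdiv : u / v = u * (starRingEnd ℂ) v := by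
    rw [div_eq_iff hv0, mul_assoc, mul_comm ((starRingEnd ℂ) v), Complex.mul_conj,
      Complex.normSq_eq_norm_sq, h1 v hv]
    simp
  rw [hdiv]
  refine Complex.pow_six_eq_one_of_norm_eq_one (hnorm u hu v hv) ?_
  have h := hzero u hu v hv huv
  simp only [hf, ht, mul_eq_zero, pow_eq_zero_iff two_ne_zero] at h
  rcases h with (h | h) | h
  · exact Or.inr (Or.inl (by linarith))
  · exact Or.inr (Or.inr (Or.inl (by linarith)))
  · exact Or.inr (Or.inr (Or.inr (by linarith)))

/-- Six points on a circle of radius `d` at mutual distances of at least `d` form a regular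
hexagon. -/
lemma mul_mem_of_ncard_eq_six {N : Set ℂ} {d : ℝ} (hd : 0 < d) (hcard : N.ncard = 6)
    (h1 : ∀ u ∈ N, ‖u‖ = d) (h2 : ∀ u ∈ N, ∀ v ∈ N, u ≠ v → d ≤ ‖u - v‖)
    {v z : ℂ} (hv : v ∈ N) (hz : z ^ 6 = 1) : v * z ∈ N := by
  classical
  have hfin : N.Finite := finite_of_ncard_ne_zero (by rw [hcard]; norm_num)
  lift N to Finset ℂ using hfin
  rw [ncard_coe_finset] at hcard
  simp only [Finset.mem_coe] at *
  have hd0 : (d : ℂ) ≠ 0 := by exact_mod_cast hd.ne'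
  have hnd : ‖(d : ℂ)‖ = d := by simp [hd.le]
  have hinj : Function.Injective fun u : ℂ => u / d := fun a b h => by simpa [hd0] using h
  have h6 : ∀ u ∈ N, (u / v) ^ 6 = 1 := fun u hu => by
    have := pow_six_eq_one_of_card_eq_six (N := N.image fun u => u / d)
      (by rw [Finset.card_image_of_injective _ hinj, hcard])
      (by simp only [Finset.forall_mem_image]
          intro u hu
          rw [norm_div, hnd, h1 u hu, div_self hd.ne'])
      (by simp only [Finset.forall_mem_image]
          intro u hu v hv huv
          rw [← sub_div, norm_div, hnd, one_le_div hd]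
          exact h2 u hu v hv fun h => huv (by rw [h]))
      (Finset.mem_image_of_mem _ hu) (Finset.mem_image_of_mem _ hv)
    rwa [div_div_div_cancel_right₀ hd0] at this
  have hv0 : v ≠ 0 := by rw [← norm_ne_zero_iff, h1 v hv]; exact hd.ne'
  -- The six quotients by `v` are sixth roots of unity, of which there are only six, so every root
  -- occurs.
  have hsub : N.image (fun u => u / v) ⊆ Polynomial.nthRootsFinset 6 (1 : ℂ) := by
    intro w hw
    obtain ⟨u, hu, rfl⟩ := Finset.mem_image.1 hw
    exact (Polynomial.mem_nthRootsFinset (by norm_num) _).2 (h6 u hu)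
  have heq := Finset.eq_of_subset_of_card_le hsub (by
    rw [Finset.card_image_of_injective _ (fun a b h => by simpa [hv0] using h), hcard,
      (Complex.isPrimitiveRoot_exp 6 (by norm_num)).card_nthRootsFinset])
  have hzm : z ∈ N.image fun u => u / v := by
    rw [heq]; exact (Polynomial.mem_nthRootsFinset (by norm_num) _).2 hz
  obtain ⟨u, hu, rfl⟩ := Finset.mem_image.1 hzm
  rwa [mul_div_cancel₀ _ hv0]

/-! ### Eisenstein integers and the rigidity of hexagonal packings -/

/-- A primitive sixth root of unity. -/
noncomputable def sixthRoot : ℂ := ⟨1 / 2, √3 / 2⟩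

lemma sixthRoot_sq : sixthRoot ^ 2 = sixthRoot - 1 := by
  have h3 : √3 * √3 = 3 := Real.mul_self_sqrt (by norm_num)
  apply Complex.ext <;> simp [sixthRoot, sq]
  · linarith
  · ring

lemma sixthRoot_pow_six : sixthRoot ^ 6 = 1 := by
  linear_combination (sixthRoot ^ 4 + sixthRoot ^ 3 - sixthRoot - 1) * sixthRoot_sq

lemma normSq_add_mul_sixthRoot (x y : ℝ) :
    Complex.normSq (x + y * sixthRoot) = x ^ 2 + x * y + y ^ 2 := by
  have h3 : √3 * √3 = 3 := Real.mul_self_sqrt (by norm_num)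
  simp [Complex.normSq_apply, sixthRoot]
  linear_combination (y ^ 2 / 4) * h3

lemma exists_eq_add_mul_sixthRoot (z : ℂ) : ∃ x y : ℝ, z = x + y * sixthRoot := by
  refine ⟨z.re - z.im / √3, 2 * z.im / √3, ?_⟩
  have h3 : √3 ≠ 0 := by positivity
  apply Complex.ext
  · simp [sixthRoot]; ring
  · simp [sixthRoot]; field_simp

/-- The ring of Eisenstein integers. -/
noncomputable def eisenstein : Subring ℂ where
  carrier := {z | ∃ x y : ℤ, z = x + y * sixthRoot}
  mul_mem' := by
    rintro _ _ ⟨a, b, rfl⟩ ⟨x, y, rfl⟩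
    refine ⟨a * x - b * y, a * y + b * x + b * y, ?_⟩
    push_cast
    linear_combination (b * y : ℂ) * sixthRoot_sq
  one_mem' := ⟨1, 0, by simp⟩
  add_mem' := by
    rintro _ _ ⟨a, b, rfl⟩ ⟨x, y, rfl⟩
    exact ⟨a + x, b + y, by push_cast; ring⟩
  zero_mem' := ⟨0, 0, by simp⟩
  neg_mem' := by
    rintro _ ⟨a, b, rfl⟩
    exact ⟨-a, -b, by push_cast; ring⟩

/-- Rounding both coordinates leaves `s² + st + t²` with `|s|, |t| ≤ 1/2`, which is at most `3/4`.
-/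
lemma exists_mem_eisenstein_norm_sub_lt_one (z : ℂ) : ∃ w ∈ eisenstein, ‖z - w‖ < 1 := by
  obtain ⟨x, y, rfl⟩ := exists_eq_add_mul_sixthRoot z
  refine ⟨_, ⟨round x, round y, rfl⟩, ?_⟩
  have h1 := abs_sub_round x
  have h2 := abs_sub_round y
  have e : (x : ℂ) + y * sixthRoot - (round x + round y * sixthRoot) =
      ((x - round x : ℝ) : ℂ) + ((y - round y : ℝ) : ℂ) * sixthRoot := by push_cast; ring
  rw [e, ← sq_lt_one_iff₀ (norm_nonneg _), ← Complex.normSq_eq_norm_sq, normSq_add_mul_sixthRoot]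
  generalize x - round x = s at h1
  generalize y - round y = t at h2
  have hs := sq_le_sq' (abs_le.1 h1).1 (abs_le.1 h1).2
  have ht := sq_le_sq' (abs_le.1 h2).1 (abs_le.1 h2).2
  nlinarith [sq_nonneg (s - t)]

lemma eisenstein_induction {H : ℂ → Prop} (h0 : H 0)
    (hstep : ∀ z, H z → ∀ u, u ^ 6 = 1 → H (z + u)) {z : ℂ} (hz : z ∈ eisenstein) : H z := by
  obtain ⟨x, y, rfl⟩ := hz
  have hx : H x := by
    induction x using Int.induction_on with
    | zero => simpa using h0
    | succ i ih => simpa using hstep _ ih 1 (by norm_num)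
    | pred i ih => simpa [sub_eq_add_neg] using hstep _ ih (-1) (by norm_num)
  induction y using Int.induction_on with
  | zero => simpa using hx
  | succ i ih =>
    have := hstep _ ih sixthRoot sixthRoot_pow_six
    push_cast
    rwa [add_mul, one_mul, ← add_assoc]
  | pred i ih =>
    have := hstep _ ih (-sixthRoot) (by rw [Even.neg_pow (by decide), sixthRoot_pow_six])
    push_cast at this ⊢
    rwa [sub_mul, one_mul, ← add_sub_assoc, sub_eq_add_neg]

/-- A planar packing in which every point has six nearest neighbours is a hexagonal lattice. -/
theorem exists_eq_setOf_sub_mem_hexagonal {P : Set ℂ} {d : ℝ} (hd : 0 < d)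
    (hsep : ∀ p ∈ P, ∀ q ∈ P, p ≠ q → d ≤ ‖p - q‖)
    (hsix : ∀ p ∈ P, {v | p + v ∈ P ∧ ‖v‖ = d}.ncard = 6) {p₀ : ℂ} (hp₀ : p₀ ∈ P) :
    ∃ v : ℂ, ‖v‖ = d ∧ P = {x | ∃ z ∈ eisenstein, x = p₀ + v * z} := by
  have hmul : ∀ p ∈ P, ∀ v z : ℂ, p + v ∈ P → ‖v‖ = d → z ^ 6 = 1 → p + v * z ∈ P :=
    fun p hp v z hv hvd hz =>
      (mul_mem_of_ncard_eq_six (N := {v | p + v ∈ P ∧ ‖v‖ = d}) hd (hsix p hp) (fun u hu => hu.2)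
        (fun u hu w hw huw => by
          have := hsep _ hu.1 _ hw.1 (by simpa using huw)
          simpa using this) ⟨hv, hvd⟩ hz).1
  have hne : {v | p₀ + v ∈ P ∧ ‖v‖ = d}.Nonempty :=
    nonempty_of_ncard_ne_zero (by rw [hsix p₀ hp₀]; norm_num)
  obtain ⟨v, hv, hvd⟩ := hne
  have hv0 : v ≠ 0 := by rw [← norm_ne_zero_iff, hvd]; exact hd.ne'
  -- The induction also carries the neighbour in direction `v`, so that the hexagon around each new
  -- point has a known vertex to rotate.
  have hall : ∀ z ∈ eisenstein, p₀ + v * z ∈ P ∧ p₀ + v * z + v ∈ P := fun z hz => by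
    refine eisenstein_induction (H := fun z => p₀ + v * z ∈ P ∧ p₀ + v * z + v ∈ P)
      (by simpa using ⟨hp₀, hv⟩) ?_ hz
    rintro z ⟨h1, h2⟩ u hu
    have hnu : ‖u‖ = 1 := Complex.norm_eq_one_of_pow_eq_one hu (by norm_num)
    have hu0 : u ≠ 0 := by rw [← norm_ne_zero_iff, hnu]; exact one_ne_zero
    have h3 := hmul _ h1 v u h2 hvd hu
    refine ⟨by rwa [mul_add, ← add_assoc], ?_⟩
    -- The old point is the neighbour of the new one in direction `-(v u)`; rotating it by `-u⁻¹`
    -- gives direction `v`.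
    have h4 := hmul _ h3 (-(v * u)) (-u⁻¹) (by simpa using h1)
      (by rw [norm_neg, norm_mul, hnu, mul_one, hvd])
      (by rw [Even.neg_pow (by decide), inv_pow, hu, inv_one])
    rw [neg_mul_neg, mul_assoc v u, mul_inv_cancel₀ hu0, mul_one] at h4
    rwa [mul_add, ← add_assoc]
  refine ⟨v, hvd, Set.ext fun x => ⟨fun hx => ?_, ?_⟩⟩
  · obtain ⟨w, hw, hlt⟩ := exists_mem_eisenstein_norm_sub_lt_one ((x - p₀) / v)
    refine ⟨w, hw, ?_⟩
    by_contra hne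
    have h1 := hsep x hx _ (hall w hw).1 hne
    have e : x - (p₀ + v * w) = v * ((x - p₀) / v - w) := by field_simp; ring
    rw [e, norm_mul, hvd] at h1
    nlinarith
  · rintro ⟨z, hz, rfl⟩
    exact (hall z hz).1

/-! ### The area bound for periodic packings -/

/-- The area bound for periodic packings in the plane, together with the local structure in the case
of equality: `T` is a set of representatives of the orbits of the packing under the period lattice
`Λ`. -/
theorem card_mul_le_volumeReal_fundamentalDomain {Λ : AddSubgroup ℂ} [Countable Λ] {F : Set ℂ}
    (hF : IsAddFundamentalDomain Λ F volume) (hFfin : volume F ≠ ⊤) {T : Finset ℂ}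
    (hT : ∀ p ∈ T, ∀ q ∈ T, p - q ∈ Λ → p = q) {P : Set ℂ} (hP : P = {x | ∃ p ∈ T, x - p ∈ Λ})
    {d : ℝ} (hd : 0 < d) (hsep : ∀ p ∈ P, ∀ q ∈ P, p ≠ q → d ≤ ‖p - q‖) :
    T.card * (√3 / 2 * d ^ 2) ≤ volume.real F ∧
      (volume.real F = T.card * (√3 / 2 * d ^ 2) →
        ∀ p ∈ P, {v | p + v ∈ P ∧ ‖v‖ = d}.ncard = 6) := by
  -- The circumradius of the regular hexagon of inradius `d/2`, the Voronoi cell in the hexagonal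
  -- lattice.
  set R := d / √3 with hR
  have hR0 : 0 < R := by positivity
  have h3 : √3 ^ 2 = 3 := Real.sq_sqrt (by norm_num)
  have hRd : 3 * R ^ 2 = d ^ 2 := by rw [hR, div_pow, h3]; field_simp
  have hPadd : ∀ x, ∀ g ∈ Λ, (x + g ∈ P ↔ x ∈ P) := fun x g hg => by
    simp only [hP, mem_ofPred_eq]
    refine exists_congr fun p => and_congr_right fun _ => ?_
    rw [add_sub_right_comm, Λ.add_mem_cancel_right hg]
  set Q : ℂ → Set ℂ := fun p => {v | p + v ∈ P ∧ v ≠ 0} with hQ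
  have hQadd : ∀ p, ∀ g ∈ Λ, Q (p + g) = Q p := fun p g hg => by
    ext v
    simp only [hQ, mem_ofPred_eq]
    rw [add_right_comm, hPadd _ g hg]
  have hQsep : ∀ p ∈ P, IsSeparatedFromZero R (Q p) := fun p hp =>
    { le_norm := fun q hq => by
        rw [hRd]
        refine pow_le_pow_left₀ hd.le ?_ 2
        have := hsep _ hq.1 p hp (by simpa using hq.2)
        simpa using this
      le_norm_sub := fun q hq q' hq' hne => by
        rw [hRd]
        refine pow_le_pow_left₀ hd.le ?_ 2
        have := hsep _ hq.1 _ hq'.1 (by simpa using hne)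
        simpa using this }
  set cell : ℂ → Set ℂ := fun p => (fun x => x - p) ⁻¹' truncatedCell R (Q p) with hcell
  have hcellmeas : ∀ p ∈ P, MeasurableSet (cell p) := fun p hp =>
    ((hQsep p hp).measurableSet_truncatedCell hR0).preimage (measurable_sub_const p)
  have hcellvol : ∀ p, volume.real (cell p) = volume.real (truncatedCell R (Q p)) := fun p => by
    simp only [hcell, Measure.real, sub_eq_add_neg, measure_preimage_add_right]
  have hcellfin : ∀ p, volume (cell p) ≠ ⊤ := fun p => by
    simp only [hcell, sub_eq_add_neg, measure_preimage_add_right]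
    exact volume_truncatedCell_ne_top R (Q p)
  have hcelldisj : ∀ p ∈ P, ∀ q ∈ P, ∀ x, x ∈ cell p → x ∈ cell q → p = q := by
    intro p hp q hq x hxp hxq
    by_contra hne
    have h1 := hxp.2 (q - p) ⟨by simpa using hq, sub_ne_zero.2 (Ne.symm hne)⟩
    have h2 := hxq.2 (p - q) ⟨by simpa using hp, sub_ne_zero.2 hne⟩
    have h5 : inner ℝ (q - p) (q - p) = ‖q - p‖ ^ 2 := real_inner_self_eq_norm_sq _
    rw [← neg_sub q p, inner_neg_right, norm_neg] at h2
    have h6 : inner ℝ (x - p) (q - p) - inner ℝ (x - q) (q - p) = ‖q - p‖ ^ 2 := by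
      rw [← inner_sub_left, sub_sub_sub_cancel_left, h5]
    linarith
  have hTP : ∀ p ∈ T, p ∈ P := fun p hp => by
    rw [hP]; exact ⟨p, hp, by rw [sub_self]; exact Λ.zero_mem⟩
  set U := ⋃ p ∈ T, cell p with hU
  have hUvol : volume.real U = ∑ p ∈ T, volume.real (truncatedCell R (Q p)) := by
    rw [hU, measureReal_biUnion_finset ?_ (fun p hp => hcellmeas p (hTP p hp))
      (fun p _ => hcellfin p)]
    · simp only [hcellvol]
    · intro p hp q hq hne
      rw [Function.onFun, Set.disjoint_left]
      exact fun x hxp hxq => hne (hcelldisj p (hTP p hp) q (hTP q hq) x hxp hxq)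
  have hUmeas : MeasurableSet U := T.measurableSet_biUnion fun p hp => hcellmeas p (hTP p hp)
  have hUmem : ∀ (g : Λ) (x : ℂ), x ∈ g +ᵥ U → ∃ p ∈ T, x ∈ cell (p + g) := by
    rintro g x ⟨y, hy, rfl⟩
    simp only [hU, mem_iUnion] at hy
    obtain ⟨p, hp, hy⟩ := hy
    refine ⟨p, hp, ?_⟩
    simp only [hcell, mem_preimage, hQadd p g g.2] at hy ⊢
    have : (g : ℂ) + y - (p + g) = y - p := by ring
    change (g : ℂ) + y - (p + g) ∈ _
    rwa [this]
  -- The translates of `U` under `Λ` are unions of cells of distinct points of `P`, hence disjoint,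
  -- so `U` has at most the area of a fundamental domain.
  have hUle : volume U ≤ volume F := by
    refine hF.measure_le_of_pairwise_disjoint hUmeas.nullMeasurableSet ?_
    intro g g' hne
    refine Disjoint.aedisjoint ?_
    rw [Set.disjoint_left]
    rintro x ⟨hx, -⟩ ⟨hx', -⟩
    obtain ⟨p, hp, hxp⟩ := hUmem g x hx
    obtain ⟨p', hp', hxp'⟩ := hUmem g' x hx'
    have heq := hcelldisj _ ((hPadd p g g.2).2 (hTP p hp)) _ ((hPadd p' g' g'.2).2 (hTP p' hp')) x
      hxp hxp'
    have hpp : p = p' := hT p hp p' hp' (by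
      rw [show p - p' = g' - g by linear_combination heq]
      exact Λ.sub_mem g'.2 g.2)
    rw [hpp] at heq
    exact hne (Subtype.ext (add_left_cancel heq))
  have hUle' : ∑ p ∈ T, volume.real (truncatedCell R (Q p)) ≤ volume.real F := by
    rw [← hUvol]
    exact ENNReal.toReal_mono hFfin hUle
  have harea : 3 * √3 / 2 * R ^ 2 = √3 / 2 * d ^ 2 := by rw [← hRd]; ring
  have hge : ∀ p ∈ T, √3 / 2 * d ^ 2 ≤ volume.real (truncatedCell R (Q p)) := fun p hp => by
    rw [← harea]; exact ((hQsep p (hTP p hp)).le_volumeReal_truncatedCell hR0).1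
  refine ⟨?_, fun hE p hp => ?_⟩
  · rw [← nsmul_eq_mul]
    exact (Finset.card_nsmul_le_sum T _ _ hge).trans hUle'
  · have hp' := hp
    rw [hP] at hp'
    obtain ⟨t, ht, hpt⟩ := hp'
    have hQp : Q p = Q t := by
      have := hQadd t _ hpt
      rwa [add_sub_cancel] at this
    have hset : {v | p + v ∈ P ∧ ‖v‖ = d} = {q ∈ Q p | ‖q‖ ^ 2 = 3 * R ^ 2} := by
      ext v
      simp only [hQ, mem_ofPred_eq, hRd, sq_eq_sq₀ (norm_nonneg v) hd.le, and_assoc]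
      refine and_congr_right fun _ => ⟨fun h => ⟨?_, h⟩, fun h => h.2⟩
      rw [← norm_ne_zero_iff, h]
      exact hd.ne'
    rw [hset, hQp]
    refine ((hQsep t (hTP t ht)).le_volumeReal_truncatedCell hR0).2 ?_
    rw [harea]
    refine le_antisymm ?_ (hge t ht)
    -- A single cell larger than the hexagon would make the total area exceed that of `F`.
    by_contra! hlt
    have := Finset.sum_lt_sum hge ⟨t, ht, hlt⟩
    rw [Finset.sum_const, nsmul_eq_mul] at this
    linarith

/-! ### Eisenstein integers of given norm -/

lemma normSq_int_add_mul_sixthRoot (x y : ℤ) :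
    Complex.normSq (x + y * sixthRoot) = ((x ^ 2 + x * y + y ^ 2 : ℤ) : ℝ) := by
  have := normSq_add_mul_sixthRoot x y
  push_cast at this ⊢
  exact this

lemma sixthRoot_mem_eisenstein : sixthRoot ∈ eisenstein := ⟨0, 1, by simp⟩

lemma conj_mem_eisenstein {z : ℂ} (hz : z ∈ eisenstein) : (starRingEnd ℂ) z ∈ eisenstein := by
  obtain ⟨x, y, rfl⟩ := hz
  have h : (starRingEnd ℂ) sixthRoot = 1 - sixthRoot := by
    apply Complex.ext <;> simp [sixthRoot]
    norm_num
  refine ⟨x + y, -y, ?_⟩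
  simp only [map_add, map_mul, map_intCast, h]
  push_cast
  ring

lemma one_le_norm_of_mem_eisenstein {z : ℂ} (hz : z ∈ eisenstein) (h0 : z ≠ 0) : 1 ≤ ‖z‖ := by
  have hpos : 0 < Complex.normSq z := Complex.normSq_pos.2 h0
  rw [← one_le_sq_iff₀ (norm_nonneg _), ← Complex.normSq_eq_norm_sq]
  obtain ⟨x, y, rfl⟩ := hz
  rw [normSq_int_add_mul_sixthRoot] at hpos ⊢
  exact_mod_cast hpos

/-- Such a `p` is inert: a nontrivial zero of the form modulo `p` would give a primitive cube root
of unity in `ZMod p`, whose unit group has order `p - 1`, prime to `3`. -/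
lemma Nat.Prime.dvd_of_dvd_sq_add_mul_add_sq {p : ℕ} (hp : p.Prime) (hp3 : p % 3 = 2) {x y : ℤ}
    (h : (p : ℤ) ∣ x ^ 2 + x * y + y ^ 2) : (p : ℤ) ∣ x ∧ (p : ℤ) ∣ y := by
  have := Fact.mk hp
  rw [← ZMod.intCast_zmod_eq_zero_iff_dvd] at h
  rw [← ZMod.intCast_zmod_eq_zero_iff_dvd, ← ZMod.intCast_zmod_eq_zero_iff_dvd]
  push_cast at h
  generalize (x : ZMod p) = a at h
  generalize (y : ZMod p) = b at h
  have hb : b = 0 := by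
    by_contra hb
    have hz : (a / b) ^ 2 + a / b + 1 = 0 := by
      field_simp
      linear_combination h
    have hz0 : a / b ≠ 0 := fun h0 => by
      rw [h0] at hz; simp at hz
    generalize a / b = z at hz hz0
    have hz3 : z ^ 3 = 1 := by linear_combination (z - 1) * hz
    have hpow := ZMod.pow_card_sub_one_eq_one hz0
    have hk : p - 1 = 3 * (p / 3) + 1 := by omega
    rw [hk, pow_succ, pow_mul, hz3, one_pow, one_mul] at hpow
    rw [hpow] at hz
    have h3 : ((3 : ℕ) : ZMod p) = 0 := by push_cast; linear_combination hz
    rw [ZMod.natCast_eq_zero_iff] at h3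
    have := (Nat.prime_dvd_prime_iff_eq hp Nat.prime_three).1 h3
    omega
  refine ⟨?_, hb⟩
  rw [hb] at h
  simpa using h

/-- The Eisenstein integers have, up to units, exactly one element of norm `n`. -/
def HasUniqueEisensteinOfNorm (n : ℕ) : Prop :=
  ∃ β ∈ eisenstein, Complex.normSq β = n ∧
    ∀ γ ∈ eisenstein, Complex.normSq γ = n → ∃ u ∈ eisenstein, Complex.normSq u = 1 ∧ γ = β * u

/-- If `κ` divides every element of norm `k m`, division by `κ` reduces uniqueness to norm `m`. -/
lemma HasUniqueEisensteinOfNorm.mul {m k : ℕ} (hm : HasUniqueEisensteinOfNorm m) {κ : ℂ}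
    (hκ : κ ∈ eisenstein) (hk : Complex.normSq κ = k) (hk0 : k ≠ 0)
    (hdvd : ∀ γ ∈ eisenstein, Complex.normSq γ = k * m → ∃ δ ∈ eisenstein, γ = κ * δ) :
    HasUniqueEisensteinOfNorm (k * m) := by
  obtain ⟨β, hβ, hβm, huniq⟩ := hm
  refine ⟨κ * β, eisenstein.mul_mem hκ hβ, by rw [Complex.normSq_mul, hk, hβm]; push_cast; ring,
    fun γ hγ hγn => ?_⟩
  obtain ⟨δ, hδ, rfl⟩ := hdvd γ hγ (by rw [hγn]; push_cast; ring)
  rw [Complex.normSq_mul, hk] at hγn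
  have hk0' : (k : ℝ) ≠ 0 := by exact_mod_cast hk0
  push_cast at hγn
  obtain ⟨u, hu, hu1, rfl⟩ := huniq δ hδ (mul_left_cancel₀ hk0' hγn)
  exact ⟨u, hu, hu1, by ring⟩

/-- The prime `3` ramifies: modulo `3` the norm form is `(y - x)²`, and `3 ∣ y - x` is exactly
divisibility by `1 + ω`, an element of norm `3`. -/
lemma exists_eq_mul_of_normSq_eq_three_mul {γ : ℂ} (hγ : γ ∈ eisenstein) {m : ℕ}
    (h : Complex.normSq γ = (3 : ℕ) * m) : ∃ δ ∈ eisenstein, γ = (1 + sixthRoot) * δ := by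
  obtain ⟨x, y, rfl⟩ := hγ
  rw [normSq_int_add_mul_sixthRoot] at h
  have h' : x ^ 2 + x * y + y ^ 2 = 3 * m := by exact_mod_cast h
  have h3 : (3 : ℤ) ∣ (y - x) ^ 2 := ⟨m - x * y, by linear_combination h'⟩
  obtain ⟨b, hb⟩ := Int.prime_three.dvd_of_dvd_pow h3
  obtain rfl : y = x + 3 * b := by linarith
  refine ⟨_, ⟨x + b, b, rfl⟩, ?_⟩
  push_cast
  linear_combination -(b : ℂ) * sixthRoot_sq

lemma exists_eq_mul_of_normSq_eq_sq_mul {p : ℕ} (hp : p.Prime) (hp3 : p % 3 = 2) {γ : ℂ}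
    (hγ : γ ∈ eisenstein) {m : ℕ} (h : Complex.normSq γ = (p ^ 2 : ℕ) * m) :
    ∃ δ ∈ eisenstein, γ = p * δ := by
  obtain ⟨x, y, rfl⟩ := hγ
  rw [normSq_int_add_mul_sixthRoot] at h
  have h' : x ^ 2 + x * y + y ^ 2 = (p ^ 2 : ℕ) * m := by exact_mod_cast h
  obtain ⟨⟨a, rfl⟩, ⟨b, rfl⟩⟩ := hp.dvd_of_dvd_sq_add_mul_add_sq hp3 (x := x) (y := y)
    ⟨p * m, by rw [h']; push_cast; ring⟩
  exact ⟨_, ⟨a, b, rfl⟩, by push_cast; ring⟩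

theorem hasUniqueEisensteinOfNorm (n : ℕ) (hn : 0 < n)
    (h1 : ∀ p : ℕ, p.Prime → p ∣ n → ¬ p ≡ 1 [MOD 3])
    (h2 : ∀ p : ℕ, p.Prime → p ∣ n → p ≡ 2 [MOD 3] → Even (n.factorization p)) :
    HasUniqueEisensteinOfNorm n := by
  induction n using Nat.strong_induction_on with
  | _ n ih =>
    rcases eq_or_ne n 1 with rfl | hn1
    · refine ⟨1, eisenstein.one_mem, by simp, fun γ hγ h => ⟨γ, hγ, by simpa using h, by simp⟩⟩
    obtain ⟨p, hp, hpn⟩ := Nat.exists_prime_and_dvd hn1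
    have hmod := h1 p hp hpn
    have h3cases : p = 3 ∨ p % 3 = 2 := by
      simp only [Nat.ModEq] at hmod
      have : p % 3 = 0 → p = 3 := fun h =>
        ((Nat.prime_dvd_prime_iff_eq Nat.prime_three hp).1 (Nat.dvd_of_mod_eq_zero h)).symm
      omega
    rcases h3cases with rfl | hp3
    · obtain ⟨m, rfl⟩ := hpn
      have hm : 0 < m := by omega
      refine (ih m (by omega) hm (fun q hq hqm => h1 q hq (hqm.mul_left 3))
        fun q hq hqm hq2 => ?_).mul (κ := 1 + sixthRoot)
        (eisenstein.add_mem eisenstein.one_mem sixthRoot_mem_eisenstein) ?_ (by norm_num)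
        fun γ hγ h => exists_eq_mul_of_normSq_eq_three_mul hγ h
      · have := h2 q hq (hqm.mul_left 3) hq2
        have hq3 : q ≠ 3 := by rintro rfl; exact absurd hq2 (by decide)
        rwa [Nat.factorization_mul (by norm_num) hm.ne', Finsupp.add_apply,
          Nat.prime_three.factorization, Finsupp.single_apply, if_neg hq3.symm, zero_add] at this
      · have := normSq_add_mul_sixthRoot 1 1
        push_cast at this ⊢
        rw [one_mul] at this
        rw [this]; norm_num
    · have heven := h2 p hp hpn hp3
      have hpos := hp.factorization_pos_of_dvd hn.ne' hpn
      -- The multiplicity of an inert prime is positive and even, so `p²` can be split off, with `κ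
      -- = p`.
      have hp2 : p ^ 2 ∣ n := (hp.pow_dvd_iff_le_factorization hn.ne').2 (by
        obtain ⟨k, hk⟩ := heven; omega)
      obtain ⟨m, rfl⟩ := hp2
      have hm : 0 < m := Nat.pos_of_mul_pos_left hn
      have hlt : m < p ^ 2 * m := lt_mul_of_one_lt_left hm (Nat.one_lt_pow two_ne_zero hp.one_lt)
      refine (ih m hlt hm (fun q hq hqm => h1 q hq (hqm.mul_left _))
        fun q hq hqm hq2 => ?_).mul (κ := p) (natCast_mem _ p) ?_ (pow_ne_zero 2 hp.ne_zero)
        fun γ hγ h => exists_eq_mul_of_normSq_eq_sq_mul hp hp3 hγ h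
      · have := h2 q hq (hqm.mul_left _) hq2
        rw [Nat.factorization_mul (pow_ne_zero 2 hp.ne_zero) hm.ne', Finsupp.add_apply,
          hp.factorization_pow, Finsupp.single_apply] at this
        split_ifs at this
        · exact (Nat.even_add.1 this).1 even_two
        · rwa [zero_add] at this
      · rw [Complex.normSq_natCast]; push_cast; ring

/-! ### The hexagonal torus and the bound for its codes -/

/-- The identification of the complex plane with the Euclidean plane. -/
noncomputable def complexPlane : ℂ ≃ₗᵢ[ℝ] EuclideanSpace ℝ (Fin 2) :=
  Complex.orthonormalBasisOneI.repr

lemma complexPlane_apply (z : ℂ) : complexPlane z = !₂[z.re, z.im] := by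
  ext i
  fin_cases i <;> simp [complexPlane]

/-- The hexagonal lattice `A₂` in the complex plane. -/
noncomputable def hexLattice : AddSubgroup ℂ :=
  latticeA2.comap (complexPlane.toLinearEquiv.toLinearMap.toAddMonoidHom)

lemma mem_hexLattice {z : ℂ} : z ∈ hexLattice ↔ complexPlane z ∈ latticeA2 := Iff.rfl

lemma mem_hexLattice_iff {z : ℂ} : z ∈ hexLattice ↔ ∃ w ∈ eisenstein, z = √2 * w := by
  have h6 : √6 = √2 * √3 := by rw [← Real.sqrt_mul (by norm_num)]; norm_num
  have e : ∀ m k : ℤ, m • !₂[√2, 0] + k • !₂[-√2 / 2, √6 / 2] =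
      complexPlane (√2 * ((m - k : ℤ) + k * sixthRoot)) := fun m k => by
    rw [complexPlane_apply]
    ext i
    fin_cases i
    · simp [sixthRoot]; ring
    · simp [sixthRoot, h6]; ring
  rw [mem_hexLattice, latticeA2, AddSubgroup.mem_closure_pair]
  constructor
  · rintro ⟨m, k, h⟩
    rw [e] at h
    exact ⟨_, ⟨m - k, k, rfl⟩, (complexPlane.injective h).symm⟩
  · rintro ⟨_, ⟨x, y, rfl⟩, rfl⟩
    refine ⟨x + y, y, ?_⟩
    rw [e, add_sub_cancel_right]

lemma le_norm_of_mem_hexLattice {z : ℂ} (hz : z ∈ hexLattice) (h0 : z ≠ 0) : √2 ≤ ‖z‖ := by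
  obtain ⟨w, hw, rfl⟩ := mem_hexLattice_iff.1 hz
  have := one_le_norm_of_mem_eisenstein hw (right_ne_zero_of_mul h0)
  rw [norm_mul, Complex.norm_real, norm_of_nonneg (by positivity)]
  exact le_mul_of_one_le_right (by positivity) this

/-- The covering of the torus `ℝ² / A₂` by the complex plane. -/
noncomputable def torusMk : ℂ →+ TorusA2 :=
  (QuotientAddGroup.mk' latticeA2).comp complexPlane.toLinearEquiv.toLinearMap.toAddMonoidHom

lemma torusMk_surjective : Function.Surjective torusMk :=
  (QuotientAddGroup.mk'_surjective _).comp complexPlane.surjective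

lemma torusMk_eq_zero {z : ℂ} : torusMk z = 0 ↔ z ∈ hexLattice :=
  QuotientAddGroup.eq_zero_iff _

lemma torusMk_eq {z w : ℂ} : torusMk z = torusMk w ↔ z - w ∈ hexLattice := by
  rw [← torusMk_eq_zero, map_sub, sub_eq_zero]

lemma norm_torusMk (z : ℂ) :
    ‖torusMk z‖ = Metric.infDist (complexPlane z) (latticeA2 : Set (EuclideanSpace ℝ (Fin 2))) :=
  QuotientAddGroup.norm_mk _

lemma norm_torusMk_le (z : ℂ) : ‖torusMk z‖ ≤ ‖z‖ := by
  rw [norm_torusMk]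
  refine (Metric.infDist_le_dist_of_mem latticeA2.zero_mem).trans ?_
  rw [dist_zero_right, LinearIsometryEquiv.norm_map]

lemma le_norm_torusMk {z : ℂ} {r : ℝ} (h : ∀ g ∈ hexLattice, r ≤ ‖z - g‖) : r ≤ ‖torusMk z‖ := by
  rw [norm_torusMk, Metric.le_infDist ⟨0, latticeA2.zero_mem⟩]
  intro y hy
  obtain ⟨g, rfl⟩ := complexPlane.surjective y
  rw [dist_eq_norm, ← map_sub, LinearIsometryEquiv.norm_map]
  exact h g hy

instance : Countable hexLattice := by
  have h : (hexLattice : Set ℂ) ⊆ range fun p : ℤ × ℤ => (√2 : ℂ) * (p.1 + p.2 * sixthRoot) := by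
    intro z hz
    obtain ⟨_, ⟨x, y, rfl⟩, rfl⟩ := mem_hexLattice_iff.1 hz
    exact ⟨(x, y), rfl⟩
  exact ((countable_range _).mono h).to_subtype

lemma exists_isAddFundamentalDomain_hexLattice :
    ∃ F : Set ℂ, IsAddFundamentalDomain hexLattice F volume ∧ volume F = ENNReal.ofReal √3 := by
  have h2 : (√2 : ℂ) ≠ 0 := by simp
  have hli : LinearIndependent ℝ ![(√2 : ℂ), √2 * sixthRoot] := by
    rw [LinearIndependent.pair_iff]
    intro s t h
    have h0 : (√2 : ℂ) * (s + t * sixthRoot) = 0 := by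
      simp only [Complex.real_smul] at h
      linear_combination h
    have h1 := (mul_eq_zero.1 h0).resolve_left h2
    have h3 := normSq_add_mul_sixthRoot s t
    rw [h1, map_zero] at h3
    have hs : s ^ 2 = 0 := by nlinarith [sq_nonneg (s / 2 + t), sq_nonneg s]
    have ht : t ^ 2 = 0 := by nlinarith [sq_nonneg (t / 2 + s), sq_nonneg t]
    exact ⟨pow_eq_zero_iff two_ne_zero |>.1 hs, pow_eq_zero_iff two_ne_zero |>.1 ht⟩
  let b : Module.Basis (Fin 2) ℝ ℂ := basisOfLinearIndependentOfCardEqFinrank hli (by simp)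
  have hb : ⇑b = ![(√2 : ℂ), √2 * sixthRoot] :=
    coe_basisOfLinearIndependentOfCardEqFinrank hli (by simp)
  have hL : (Submodule.span ℤ (range b)).toAddSubgroup = hexLattice := by
    ext z
    rw [Submodule.mem_toAddSubgroup, hb, Matrix.range_cons, Matrix.range_cons, Matrix.range_empty,
      union_empty, singleton_union, Submodule.mem_span_pair, mem_hexLattice_iff]
    constructor
    · rintro ⟨x, y, rfl⟩
      exact ⟨_, ⟨x, y, rfl⟩, by simp; ring⟩
    · rintro ⟨_, ⟨x, y, rfl⟩, rfl⟩
      exact ⟨x, y, by simp; ring⟩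
  refine ⟨ZSpan.fundamentalDomain b, ?_, ?_⟩
  · have := ZSpan.isAddFundamentalDomain' b volume
    rwa [hL] at this
  · rw [ZSpan.measure_fundamentalDomain b volume Complex.orthonormalBasisOneI.toBasis,
      measure_congr (ZSpan.fundamentalDomain_ae_parallelepiped _ _)]
    have h1 := Complex.orthonormalBasisOneI.volume_parallelepiped
    rw [OrthonormalBasis.coe_toBasis, h1, mul_one, Module.Basis.det_apply, Matrix.det_fin_two]
    congr 1
    simp only [Module.Basis.toMatrix_apply, hb, OrthonormalBasis.coe_toBasis_repr_apply]
    have h22 : √2 * √2 = 2 := Real.mul_self_sqrt (by norm_num)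
    have h3 : 0 ≤ √3 / 2 := by positivity
    simp [sixthRoot, abs_mul, abs_of_nonneg h3, abs_of_nonneg (Real.sqrt_nonneg 2)]
    linear_combination (√3 / 2) * h22

/-- The bound `n d² ≤ 2` for a code of size `n` and minimum distance at least `d` in the torus; if it
is attained, the preimage of the code in the plane is a translate of a hexagonal lattice. -/
lemma card_mul_sq_le_two {n : ℕ} {C : Set TorusA2} (hC : C.Finite) (hn : C.ncard = n) {d : ℝ}
    (hd : 0 < d) (hd2 : d ≤ √2) (hsep : ∀ x ∈ C, ∀ y ∈ C, x ≠ y → d ≤ dist x y) :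
    (n : ℝ) * d ^ 2 ≤ 2 ∧ ((n : ℝ) * d ^ 2 = 2 → ∀ p, torusMk p ∈ C →
      ∃ v : ℂ, ‖v‖ = d ∧ torusMk ⁻¹' C = {x | ∃ z ∈ eisenstein, x = p + v * z}) := by
  classical
  obtain ⟨F, hF, hFvol⟩ := exists_isAddFundamentalDomain_hexLattice
  lift C to Finset TorusA2 using hC
  rw [ncard_coe_finset] at hn
  simp only [Finset.mem_coe] at hsep ⊢
  let s := Function.surjInv torusMk_surjective
  have hs : ∀ x, torusMk (s x) = x := Function.surjInv_eq torusMk_surjective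
  have hPsep : ∀ p ∈ torusMk ⁻¹' (C : Set TorusA2), ∀ q ∈ torusMk ⁻¹' (C : Set TorusA2), p ≠ q →
      d ≤ ‖p - q‖ := by
    intro p hp q hq hpq
    -- Distinct lifts of one code point differ by a nonzero lattice vector, of length at least `√2`;
    -- this is where `d ≤ √2` enters.
    by_cases h : torusMk p = torusMk q
    · exact hd2.trans (le_norm_of_mem_hexLattice (torusMk_eq.1 h) (sub_ne_zero.2 hpq))
    · refine (hsep _ hp _ hq h).trans ?_
      rw [dist_eq_norm, ← map_sub]
      exact norm_torusMk_le _
  obtain ⟨h1, h2⟩ := card_mul_le_volumeReal_fundamentalDomain hF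
    (by rw [hFvol]; exact ENNReal.ofReal_ne_top) (T := C.image s)
    (by simp only [Finset.forall_mem_image]
        intro x hx y hy hxy
        rw [← torusMk_eq, hs, hs] at hxy
        rw [hxy])
    (P := torusMk ⁻¹' (C : Set TorusA2))
    (by ext x
        simp only [mem_preimage, Finset.mem_coe, mem_ofPred_eq, Finset.exists_mem_image,
          ← torusMk_eq, hs]
        simp) hd hPsep
  rw [Finset.card_image_of_injective _ (Function.injective_surjInv _), hn, Measure.real, hFvol,
    ENNReal.toReal_ofReal (by positivity)] at h1 h2
  have h3 : 0 < √3 := by positivity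
  refine ⟨by nlinarith, fun hE p hp => ?_⟩
  exact exists_eq_setOf_sub_mem_hexagonal hd hPsep (h2 (by linear_combination (-√3 / 2) * hE)) hp

/-! ### Lattice codes -/

/-- The homomorphism to the torus whose range is the image of the lattice `√2 β⁻¹ ℤ[ω]`. -/
noncomputable def latticeCode (β : ℂ) : (Fin 2 → ℤ) →+ TorusA2 :=
  torusMk.comp
    { toFun := fun x => √2 / β * (x 0 + x 1 * sixthRoot)
      map_zero' := by simp
      map_add' := fun x y => by simp; ring }

lemma latticeCode_apply (β : ℂ) (x : Fin 2 → ℤ) :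
    latticeCode β x = torusMk (√2 / β * (x 0 + x 1 * sixthRoot)) := rfl

lemma mem_range_latticeCode {β : ℂ} {t : TorusA2} :
    t ∈ (latticeCode β).range ↔ ∃ z ∈ eisenstein, torusMk (√2 / β * z) = t := by
  constructor
  · rintro ⟨x, rfl⟩
    exact ⟨_, ⟨x 0, x 1, rfl⟩, rfl⟩
  · rintro ⟨_, ⟨x, y, rfl⟩, rfl⟩
    exact ⟨![x, y], by simp [latticeCode_apply]⟩

lemma mul_div_mem_hexLattice_iff {β : ℂ} (hβ0 : β ≠ 0) {z : ℂ} :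
    √2 / β * z ∈ hexLattice ↔ ∃ w ∈ eisenstein, z = β * w := by
  have h2 : (√2 : ℂ) ≠ 0 := by simp
  rw [mem_hexLattice_iff]
  refine exists_congr fun w => and_congr_right fun _ => ⟨fun h => ?_, fun h => ?_⟩
  · field_simp at h
    rw [h]
  · rw [h]; field_simp

/-- The kernel is `β ℤ[ω]` in coordinates, whose index in `ℤ²` is the determinant of multiplication
by `β`, that is, its norm. -/
lemma card_range_latticeCode {n : ℕ} (hn : 0 < n) {β : ℂ} (hβ : β ∈ eisenstein)
    (hβn : Complex.normSq β = n) : Nat.card (latticeCode β).range = n := by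
  have hβ0 : β ≠ 0 := by
    rintro rfl
    rw [map_zero] at hβn
    exact hn.ne (by exact_mod_cast hβn)
  obtain ⟨a, b, hab⟩ := hβ
  -- Multiplication by `a + bω` in the basis `1, ω`, using `ω² = ω - 1`.
  let A : Matrix (Fin 2) (Fin 2) ℤ := !![a, -b; b, a + b]
  have hAdet : A.det = n := by
    rw [hab, normSq_int_add_mul_sixthRoot] at hβn
    rw [Matrix.det_fin_two_of]
    have : a ^ 2 + a * b + b ^ 2 = (n : ℤ) := by exact_mod_cast hβn
    linarith
  have hmul : ∀ x : Fin 2 → ℤ, ((A.mulVec x 0 : ℤ) : ℂ) + (A.mulVec x 1 : ℤ) * sixthRoot =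
      β * (x 0 + x 1 * sixthRoot) := fun x => by
    simp only [A, Matrix.mulVec, dotProduct, Fin.sum_univ_two, hab]
    simp
    linear_combination (-b * x 1 : ℂ) * sixthRoot_sq
  let f : (Fin 2 → ℤ) →ₗ[ℤ] (Fin 2 → ℤ) := Matrix.toLin' A
  have hfdet : LinearMap.det f = n := by rw [LinearMap.det_toLin', hAdet]
  have hinj : Function.Injective f := by
    rw [← LinearMap.ker_eq_bot]
    refine LinearMap.ker_eq_bot'.2 fun x hx => ?_
    exact Matrix.eq_zero_of_mulVec_eq_zero (by rw [hAdet]; exact_mod_cast hn.ne')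
      (by rwa [Matrix.toLin'_apply] at hx)
  have hker : (latticeCode β).ker = (LinearMap.range f).toAddSubgroup := by
    ext x
    rw [AddMonoidHom.mem_ker, latticeCode_apply, torusMk_eq_zero, mul_div_mem_hexLattice_iff hβ0,
      Submodule.mem_toAddSubgroup, LinearMap.mem_range]
    have hcoord : ∀ u v : Fin 2 → ℤ,
        (u 0 : ℂ) + u 1 * sixthRoot = v 0 + v 1 * sixthRoot → u = v := fun u v h => by
      have h1 := normSq_int_add_mul_sixthRoot (u 0 - v 0) (u 1 - v 1)
      have h2 : (((u 0 - v 0 : ℤ) : ℂ) + ((u 1 - v 1 : ℤ) : ℂ) * sixthRoot) = 0 := by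
        push_cast; linear_combination h
      rw [h2, map_zero] at h1
      have h3 : (u 0 - v 0) ^ 2 + (u 0 - v 0) * (u 1 - v 1) + (u 1 - v 1) ^ 2 = 0 := by
        exact_mod_cast h1.symm
      have h4 : (u 0 - v 0) ^ 2 = 0 := by
        nlinarith [sq_nonneg (u 0 - v 0 + 2 * (u 1 - v 1)), sq_nonneg (u 0 - v 0)]
      have h5 : (u 1 - v 1) ^ 2 = 0 := by
        nlinarith [sq_nonneg (u 1 - v 1 + 2 * (u 0 - v 0)), sq_nonneg (u 1 - v 1)]
      ext i
      fin_cases i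
      · exact sub_eq_zero.1 (pow_eq_zero_iff two_ne_zero |>.1 h4)
      · exact sub_eq_zero.1 (pow_eq_zero_iff two_ne_zero |>.1 h5)
    constructor
    · rintro ⟨_, ⟨y0, y1, rfl⟩, h⟩
      refine ⟨![y0, y1], ?_⟩
      rw [Matrix.toLin'_apply]
      refine hcoord _ _ ?_
      rw [hmul, h]
      simp
    · rintro ⟨y, rfl⟩
      exact ⟨_, ⟨y 0, y 1, rfl⟩, by rw [Matrix.toLin'_apply, hmul]⟩
  rw [← AddSubgroup.index_ker, hker]
  have h := Submodule.natAbs_det_equiv (LinearMap.range f) (LinearEquiv.ofInjective f hinj)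
  have hcomp : (LinearMap.range f).subtype ∘ₗ
      AddMonoidHom.toIntLinearMap ((LinearEquiv.ofInjective f hinj : _ ≃ₗ[ℤ] _) :
        (Fin 2 → ℤ) →+ LinearMap.range f) = f := by
    ext1 x; rfl
  rw [hcomp, hfdet] at h
  exact h.symm

/-- Lifts of distinct code points differ by `√2 β⁻¹` times a nonzero Eisenstein integer, whose norm
is at least `1`. -/
lemma le_dist_of_mem_range_latticeCode {n : ℕ} (hn : 0 < n) {β : ℂ} (hβ : β ∈ eisenstein)
    (hβn : Complex.normSq β = n) {x y : TorusA2} (hx : x ∈ (latticeCode β).range)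
    (hy : y ∈ (latticeCode β).range) (hxy : x ≠ y) : √(2 / n) ≤ dist x y := by
  have hβ0 : β ≠ 0 := by
    rintro rfl
    rw [map_zero] at hβn
    exact hn.ne (by exact_mod_cast hβn)
  have hnorm : ‖β‖ = √n := by
    rw [← hβn, Complex.normSq_eq_norm_sq, Real.sqrt_sq (norm_nonneg _)]
  have hsub := (latticeCode β).range.sub_mem hx hy
  rw [dist_eq_norm]
  obtain ⟨z, hz, h⟩ := mem_range_latticeCode.1 hsub
  rw [← sub_ne_zero, ← h, Ne, torusMk_eq_zero, mul_div_mem_hexLattice_iff hβ0] at hxy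
  rw [← h]
  refine le_norm_torusMk fun g hg => ?_
  obtain ⟨w, hw, rfl⟩ := mem_hexLattice_iff.1 hg
  have e : √2 / β * z - √2 * w = √2 / β * (z - β * w) := by field_simp
  have h1 : 1 ≤ ‖z - β * w‖ :=
    one_le_norm_of_mem_eisenstein (eisenstein.sub_mem hz (eisenstein.mul_mem hβ hw))
      (sub_ne_zero.2 fun h => hxy ⟨w, hw, h⟩)
  rw [e, norm_mul, norm_div, hnorm, Complex.norm_real, norm_of_nonneg (by positivity),
    Real.sqrt_div (by norm_num)]
  exact le_mul_of_one_le_right (by positivity) h1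

/-! ### Optimality and uniqueness -/

/-- Let `n` be a positive integer none of whose prime factors is `1` mod `3` and each of whose prime
factors that is `2` mod `3` has even multiplicity. Then the optimal code of size `n` in the
hexagonal torus `ℝ² / A₂` is unique up to isometry. -/
theorem lemma4p11 (n : ℕ) (hn : 0 < n)
    (h1 : ∀ p : ℕ, p.Prime → p ∣ n → ¬ p ≡ 1 [MOD 3])
    (h2 : ∀ p : ℕ, p.Prime → p ∣ n → p ≡ 2 [MOD 3] → Even (n.factorization p)) :
    HasUniqueOptimalCode TorusA2 n := by
  obtain ⟨β, hβ, hβn, huniq⟩ := hasUniqueEisensteinOfNorm n hn h1 h2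
  have hβ0 : β ≠ 0 := by
    rintro rfl
    rw [map_zero] at hβn
    exact hn.ne (by exact_mod_cast hβn)
  have hn0 : (0 : ℝ) < n := by exact_mod_cast hn
  set r := √(2 / n) with hr
  have hr0 : 0 < r := by positivity
  have hr2 : r ^ 2 = 2 / n := Real.sq_sqrt (by positivity)
  have hnr : (n : ℝ) * r ^ 2 = 2 := by rw [hr2]; field_simp
  have hr2' : r ≤ √2 := Real.sqrt_le_sqrt (div_le_self (by norm_num) (by exact_mod_cast hn))
  set C₀ : Set TorusA2 := ((latticeCode β).range : Set TorusA2) with hC₀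
  have hcard : C₀.ncard = n := card_range_latticeCode hn hβ hβn
  have hfin : C₀.Finite := finite_of_ncard_ne_zero (by rw [hcard]; exact hn.ne')
  have hsep₀ : ENNReal.ofReal r ≤ C₀.einfsep := le_einfsep fun x hx y hy hxy => by
    rw [edist_dist]
    exact ENNReal.ofReal_le_ofReal (le_dist_of_mem_range_latticeCode hn hβ hβn hx hy hxy)
  have hdist : ∀ (C : Set TorusA2) (d : ℝ), ENNReal.ofReal d ≤ C.einfsep →
      ∀ x ∈ C, ∀ y ∈ C, x ≠ y → d ≤ dist x y := fun C d h x hx y hy hxy => by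
    have := le_edist_of_le_einfsep hx hy hxy h
    rwa [edist_dist, ENNReal.ofReal_le_ofReal_iff dist_nonneg] at this
  refine ⟨C₀, ⟨⟨hfin, hcard⟩, fun C hC hCn => ?_⟩, fun C hC => ?_⟩
  · by_contra! hlt
    -- For `n > 1` a real `d ≤ √2` fits strictly between `r` and the supposedly larger separation,
    -- contradicting `n d² ≤ 2`. For `n = 1` the separation of `C₀` is already `∞`.
    rcases Nat.lt_or_ge 1 n with hn1 | hn1
    · have hlt2 : r < √2 :=
        Real.sqrt_lt_sqrt (by positivity) (div_lt_self (by norm_num) (by exact_mod_cast hn1))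
      have hlt3 : ENNReal.ofReal r < min C.einfsep (ENNReal.ofReal √2) :=
        lt_min (hsep₀.trans_lt hlt) ((ENNReal.ofReal_lt_ofReal_iff (by positivity)).2 hlt2)
      obtain ⟨d, hd1, hd2⟩ := ENNReal.lt_iff_exists_nnreal_btwn.1 hlt3
      rw [lt_min_iff] at hd2
      rw [← ENNReal.ofReal_coe_nnreal] at hd1 hd2
      have hrd := (ENNReal.ofReal_lt_ofReal_iff_of_nonneg hr0.le).1 hd1
      have hd2' := (ENNReal.ofReal_lt_ofReal_iff (by positivity)).1 hd2.2
      have := (card_mul_sq_le_two hC hCn (hr0.trans hrd) hd2'.le (hdist C d hd2.1.le)).1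
      nlinarith [pow_lt_pow_left₀ hrd hr0.le two_ne_zero]
    · have hsub : C₀.Subsingleton := by
        have := hfin.to_subtype
        exact ncard_le_one_iff_subsingleton.1 (hcard.trans_le hn1)
      rw [hsub.einfsep] at hlt
      exact not_top_lt hlt
  · obtain ⟨⟨hCfin, hCn⟩, hCopt⟩ := hC
    have hne : C.Nonempty := nonempty_of_ncard_ne_zero (by rw [hCn]; exact hn.ne')
    obtain ⟨t, ht⟩ := hne
    obtain ⟨p, rfl⟩ := torusMk_surjective t
    obtain ⟨v, hv, hP⟩ := (card_mul_sq_le_two hCfin hCn hr0 hr2'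
      (hdist C r (hsep₀.trans (hCopt C₀ hfin hcard)))).2 hnr p ht
    -- The lift of `C` is invariant under `A₂`, so its lattice of differences `v ℤ[ω]` contains
    -- `√2`; the quotient `γ` then has norm `2 / r² = n`.
    have hperiod : p + √2 ∈ torusMk ⁻¹' C := by
      have : torusMk (p + √2) = torusMk p := by
        rw [torusMk_eq, add_sub_cancel_left, mem_hexLattice_iff]
        exact ⟨1, eisenstein.one_mem, by rw [mul_one]⟩
      rwa [mem_preimage, this]
    rw [hP] at hperiod
    obtain ⟨γ, hγ, hγ'⟩ := hperiod
    have hvγ : (√2 : ℂ) = v * γ := add_left_cancel hγ'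
    have hγn : Complex.normSq γ = n := by
      have := congrArg Complex.normSq hvγ
      rw [Complex.normSq_mul, Complex.normSq_ofReal, Real.mul_self_sqrt (by norm_num),
        Complex.normSq_eq_norm_sq v, hv] at this
      refine mul_left_cancel₀ (pow_pos hr0 2).ne' ?_
      linarith
    obtain ⟨u, hu, hu1, rfl⟩ := huniq γ hγ hγn
    have huu : u * (starRingEnd ℂ) u = 1 := by rw [Complex.mul_conj, hu1, Complex.ofReal_one]
    have hc : √2 / β = v * u := by rw [hvγ]; field_simp
    -- Since `√2 β⁻¹ = v u` with `u` a unit whose inverse is its conjugate, `√2 β⁻¹ ℤ[ω] = v ℤ[ω]`: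
    -- thus `C` is `C₀` translated by the image of `p`.
    have hmem : ∀ x, torusMk x ∈ C ↔ torusMk x - torusMk p ∈ C₀ := fun x => by
      rw [hC₀, SetLike.mem_coe, mem_range_latticeCode]
      have hx : torusMk x ∈ C ↔ ∃ z ∈ eisenstein, x = p + v * z := by
        change x ∈ torusMk ⁻¹' C ↔ _
        rw [hP]; rfl
      rw [hx]
      constructor
      · rintro ⟨z, hz, rfl⟩
        refine ⟨(starRingEnd ℂ) u * z, eisenstein.mul_mem (conj_mem_eisenstein hu) hz, ?_⟩
        rw [← map_sub, add_sub_cancel_left, hc]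
        congr 1
        linear_combination (v * z) * huu
      · rintro ⟨z, hz, h⟩
        rw [← map_sub, torusMk_eq, mem_hexLattice_iff] at h
        obtain ⟨w, hw, h⟩ := h
        -- Lifting the equation in the torus adds a period `√2 w`, which is `v β u w`.
        refine ⟨u * z - β * u * w, eisenstein.sub_mem (eisenstein.mul_mem hu hz)
          (eisenstein.mul_mem (eisenstein.mul_mem hβ hu) hw), ?_⟩
        rw [hc, hvγ] at h
        linear_combination -h
    refine ⟨IsometryEquiv.subRight (torusMk p), ?_⟩
    ext t
    constructor
    · rintro ⟨s, hs, rfl⟩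
      obtain ⟨x, rfl⟩ := torusMk_surjective s
      exact (hmem x).1 hs
    · intro htC
      refine ⟨t + torusMk p, ?_, add_sub_cancel_right _ _⟩
      obtain ⟨x, rfl⟩ := torusMk_surjective t
      rw [← map_add, hmem, map_add, add_sub_cancel_right]
      exact htC
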